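/- Let $M>0$ be a fixed constant, let $q\ge 1$ be a fixed integer, and let $n=m^q$ with $m\ge 1$ an integer. Let $\mathbb L_{q,n}=\{\tfrac1{m},\tfrac2{m},\dots,1\}^q$ (so $m=n^{1/q}$) be the lattice with $n$ points $l_1,\dots,l_n$ in $[0,1]^q$, and let $$Q_{-M,M}=\{(f(l_1),\dots,f(l_n)) : f\colon[0,1]^q\to[-M,M]\ \text{non-decreasing in each variable}\}\subset\mathbb R^n .$$ One observes $Y=(Y_1,\dots,Y_n)$, where the $Y_i\sim\mathrm{Ber}(p_i)$ are independent and the log-odds vector $\theta=(\theta_1,\dots,\theta_n)$, $\theta_i=\log\frac{p_i}{1-p_i}$, belongs to $Q_{-M,M}$. Let $$R_{q,n}=\inf_{\hat\theta}\ \sup_{\theta\in Q_{-M,M}}\ \mathbb E_\theta\|\hat\theta(Y)-\theta\|^2$$ be the minimax risk in squared Euclidean norm, the infimum being over all measurable functions $\hat\theta$ of the data. Then: 1. If $q=1$, there are constants $0<c\le C<\infty$ depending only on $M$ such that $c\,n^{1/3}\le R_{1,n}\le C\,n^{1/3}$ for all $n\ge1$. 2. If $q=2$, there is a constant $0<C<\infty$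 depending only on $M$ such that $R_{2,n}\le C\sqrt n\,\log n$ for all $n=m^2\ge 2$. 3. If $q\ge3$, there are constants $0<c\le C<\infty$ depending only on $M$ and $q$ such that $c\,n^{1-1/q}\le R_{q,n}\le C\,n^{1-1/q}$ for all $n=m^q\ge1$. -/

import Mathlib

open scoped ENNReal

namespace MonotoneBernoulli

/-- A function on the cube `[0,1]^q` is non-decreasing in each variable
(all other variables being held fixed). -/
def NondecreasingInEachVariable {q : ℕ} (f : (Fin q → unitInterval) → ℝ) : Prop :=
  ∀ (z : Fin q → unitInterval) (i : Fin q) (t : unitInterval),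
    z i ≤ t → f z ≤ f (Function.update z i t)

/-- Being non-decreasing in each variable is monotonicity for the product order. -/
theorem nondecreasingInEachVariable_iff_monotone {q : ℕ} (f : (Fin q → unitInterval) → ℝ) :
    NondecreasingInEachVariable f ↔ Monotone f := by
  constructor
  · intro h x y hxy
    have key : ∀ s : Finset (Fin q), f x ≤ f (s.piecewise y x) := by
      intro s
      induction s using Finset.induction_on with
      | empty => simp
      | insert a s ha ih =>
        rw [Finset.piecewise_insert]
        refine ih.trans (h _ a _ ?_)
        simpa [ha] using hxy a
    simpa using key Finset.univ
  · intro h z i t hzt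
    exact h (le_update_iff.2 ⟨hzt, fun _ _ => le_rfl⟩)

/-- The class of functions `[0,1]^q → [a,b]` that are non-decreasing in each variable. -/
def monotoneClass (q : ℕ) (a b : ℝ) : Set ((Fin q → unitInterval) → ℝ) :=
  {f | (∀ z, f z ∈ Set.Icc a b) ∧ NondecreasingInEachVariable f}

/-- The point `((k₁+1)/m, …, (k_q+1)/m)` of the lattice `{1/m, 2/m, …, 1}^q`. -/
noncomputable def latticePoint {q m : ℕ} (k : Fin q → Fin m) : Fin q → unitInterval :=
  fun j => ⟨((k j : ℕ) + 1 : ℝ) / (m : ℝ), by positivity,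
    div_le_one_of_le₀ (by exact_mod_cast (k j).isLt) (by positivity)⟩

/-- The set of evaluations, at the `m ^ q` points of the lattice `{1/m, …, 1}^q`, of the
functions `[0,1]^q → [a,b]` that are non-decreasing in each variable, as a subset of
Euclidean space of dimension `m ^ q` (with coordinates indexed by the lattice points). -/
def evaluations (q m : ℕ) (a b : ℝ) : Set (EuclideanSpace ℝ (Fin q → Fin m)) :=
  {θ | ∃ f ∈ monotoneClass q a b, ∀ k, θ k = f (latticePoint k)}

/-- The law `Ber(p)` on `{false, true}` whose log-odds `log (p / (1 - p))` equals `t`, that is,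
`p = 1 / (1 + exp (-t))`. -/
noncomputable def berLogOdds (t : ℝ) : MeasureTheory.Measure Bool :=
  ProbabilityTheory.bernoulliMeasure true false (unitInterval.sigmoid t)

/-- The log-odds of `berLogOdds t` is `t`. -/
theorem log_odds_berLogOdds (t : ℝ) :
    Real.log ((berLogOdds t).real {true} / (1 - (berLogOdds t).real {true})) = t := by
  have h : (berLogOdds t).real {true} = Real.sigmoid t := by
    unfold berLogOdds
    rw [ProbabilityTheory.bernoulliMeasure_real_apply_of_mem_of_notMem (unitInterval.sigmoid t)
      (MeasurableSet.singleton true) (by simp) (by simp)]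
    rfl
  have h0 := Real.sigmoid_pos t
  rw [h, ← Real.sigmoid_neg, ← Real.sigmoid_mul_rexp_neg, Real.exp_neg]
  field_simp
  simp

/-- The law of independent observations `Y i ~ Ber(p i)` with `θ i = log (p i / (1 - p i))`. -/
noncomputable def dataLaw {ι : Type*} [Fintype ι] (θ : EuclideanSpace ℝ ι) :
    MeasureTheory.Measure (ι → Bool) :=
  MeasureTheory.Measure.pi fun i => berLogOdds (θ i)

/-- The minimax risk `inf_T sup_{θ ∈ K} E_θ ‖T(Y) - θ‖²` for estimating the log-odds vector `θ`
from independent Bernoulli observations, over all measurable estimators `T`. -/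
noncomputable def minimaxRisk {ι : Type*} [Fintype ι] (K : Set (EuclideanSpace ℝ ι)) : ℝ≥0∞ :=
  ⨅ (T : (ι → Bool) → EuclideanSpace ℝ ι) (_ : Measurable T),
    ⨆ θ ∈ K, ∫⁻ y, ENNReal.ofReal (‖T y - θ‖ ^ 2) ∂(dataLaw θ)

end MonotoneBernoulli

/-!
The sigmoid and its inverse are Lipschitz on the relevant compact intervals, so estimating the
log-odds is equivalent, up to constants depending on `M`, to estimating the success probabilities
`p i` (`minimaxRisk_le_of_estimator`), and the noise `Y i - p i` is independent, centred and
sub-Gaussian (`integral_exp_noise_le`).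

*Lower bounds.* The squared Hellinger affinity of two Bernoulli laws with log-odds `s`, `t` is at
least `1 - (s - t)² / 4`, so Assouad's lemma (`le_minimaxRisk_of_bump`) applies to families of
monotone vectors whose values on disjoint blocks can be chosen independently. In dimension `q` each
point of the largest layer `∑ j, x j = s`, an antichain with at least `m ^ (q - 1) / q` points, is a
block of its own (`le_minimaxRisk_evaluations`). In dimension one there are about `m ^ (1 / 3)`
blocks of length `m ^ (2 / 3)` with jumps of height `m ^ (-1 / 3)`
(`le_minimaxRisk_evaluations_one`).

*Upper bound, `q = 1`.* The max-min estimator over windows with dyadic arms has, at each index `i`,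
risk at most a constant times `(p (i ± 2 ^ k) - p i)² + 2 ^ (-k)` for every `k` at once. Balancing
over `k` bounds it by `2 ^ (-K) + ∑ k ≤ K, 2 ^ (-k / 2) |p (i ± 2 ^ k) - p i|`
(`le_sum_of_le_drift`), and since `p` has total variation at most `1` the drifts over arms of length
`2 ^ k` sum to at most `2 ^ k`. With `2 ^ K` of order `m ^ (2 / 3)` the total is of order
`m ^ (1 / 3)` (`sum_risk_dyadicMaxMin_le`).

*Upper bound, `q ≥ 2`.* The loss of the least squares estimator over monotone vectors is at most
twice the noise integrated against the error, and by the layer-cake formula it is enough to bound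
the expected maximum of the noise summed over an upper set. An upper set is a disjoint union of
shells, one for each dyadic scale, and a trivial set (`exists_sum_upperSet_le`). At scale `2 ^ j`
there are at most `exp (C (m / 2 ^ j) ^ (q - 1))` shells, because an upper set of
`{0, …, a - 1} ^ q` is determined by the lattice paths bounding its `a ^ (q - 2)` two-dimensional
slices (`card_upperFinsets_le`), and each shell has at most `C m ^ (q - 1) 2 ^ j` points, because it
meets a diagonal in a stretch shorter than
`2 ^ (j + 1)` (`card_dyadicShell_le`). The maximal inequality therefore gives
`C m ^ (q - 1) 2 ^ (-j (q - 2) / 2)` at scale `2 ^ j`. For `q ≥ 3` this is summable in `j`; for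
`q = 2` the `log m` scales contribute equally.
-/

namespace MonotoneBernoulli

open MeasureTheory ProbabilityTheory Finset

/-! ### Bernoulli noise and the reduction to success probabilities -/

section Probability

variable {ι : Type*} [Fintype ι]

instance isProbabilityMeasure_berLogOdds (t : ℝ) : IsProbabilityMeasure (berLogOdds t) := by
  unfold berLogOdds; infer_instance

instance isProbabilityMeasure_dataLaw (θ : EuclideanSpace ℝ ι) :
    IsProbabilityMeasure (dataLaw θ) := by
  unfold dataLaw; infer_instance

lemma berLogOdds_real_true (t : ℝ) : (berLogOdds t).real {true} = Real.sigmoid t := by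
  unfold berLogOdds
  rw [bernoulliMeasure_real_apply_of_mem_of_notMem _ (MeasurableSet.singleton true) (by simp)
      (by simp)]
  rfl

lemma berLogOdds_real_false (t : ℝ) : (berLogOdds t).real {false} = 1 - Real.sigmoid t := by
  unfold berLogOdds
  rw [bernoulliMeasure_real_apply_of_notMem_of_mem _ (MeasurableSet.singleton false)
      (by simp) (by simp)]
  rfl

lemma integral_berLogOdds (t : ℝ) (f : Bool → ℝ) :
    ∫ b, f b ∂(berLogOdds t) = Real.sigmoid t * f true + (1 - Real.sigmoid t) * f false := by
  rw [integral_fintype Integrable.of_finite, Fintype.sum_bool, berLogOdds_real_true,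
    berLogOdds_real_false, smul_eq_mul, smul_eq_mul]

/-- The numerical value of a binary observation. -/
def outcome (b : Bool) : ℝ := if b then 1 else 0

/-- The centred observation `Y i - p i`, where `p i = sigmoid (θ i)`. -/
noncomputable def noise (θ : EuclideanSpace ℝ ι) (y : ι → Bool) (i : ι) : ℝ :=
  outcome (y i) - Real.sigmoid (θ i)

lemma integral_prod_dataLaw (θ : EuclideanSpace ℝ ι) (f : ι → Bool → ℝ) :
    ∫ y, ∏ i, f i (y i) ∂(dataLaw θ) = ∏ i, ∫ b, f i b ∂(berLogOdds (θ i)) :=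
  integral_fintype_prod_eq_prod f

lemma integral_outcome (t : ℝ) : ∫ b, outcome b ∂(berLogOdds t) = Real.sigmoid t := by
  rw [integral_berLogOdds]; simp [outcome]

lemma integral_exp_noise_le (θ : EuclideanSpace ℝ ι) (a : ι → ℝ) :
    ∫ y, Real.exp (∑ i, a i * noise θ y i) ∂(dataLaw θ) ≤ Real.exp ((∑ i, a i ^ 2) / 8) := by
  have key (i : ι) : ∫ b, Real.exp (a i * (outcome b - Real.sigmoid (θ i))) ∂(berLogOdds (θ i))
      ≤ Real.exp (a i ^ 2 / 8) := by
    have h := (hasSubgaussianMGF_of_mem_Icc (μ := berLogOdds (θ i)) (X := outcome) (a := 0) (b := 1)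
      (measurable_of_finite _).aemeasurable
      (Filter.Eventually.of_forall fun b => by cases b <;> simp [outcome])).mgf_le (a i)
    rw [integral_outcome] at h
    refine h.trans (Real.exp_le_exp.2 (le_of_eq ?_))
    simp
    ring
  simp_rw [Real.exp_sum, noise]
  rw [integral_prod_dataLaw θ fun i b => Real.exp (a i * (outcome b - Real.sigmoid (θ i))),
    Finset.sum_div, Real.exp_sum]
  exact Finset.prod_le_prod (fun i _ => integral_nonneg fun _ => (Real.exp_pos _).le)
    fun i _ => key i

lemma integral_noise (θ : EuclideanSpace ℝ ι) (i : ι) : ∫ y, noise θ y i ∂(dataLaw θ) = 0 := by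
  have h : ∫ y, outcome (y i) ∂(dataLaw θ) = Real.sigmoid (θ i) := by
    rw [← integral_outcome]
    exact integral_comp_eval (μ := fun i => berLogOdds (θ i)) (f := outcome)
      (measurable_of_finite _).aestronglyMeasurable
  simp only [noise]
  rw [integral_sub Integrable.of_finite Integrable.of_finite, h]
  simp

lemma integral_sum_noise (θ : EuclideanSpace ℝ ι) (a : ι → ℝ) :
    ∫ y, ∑ i, a i * noise θ y i ∂(dataLaw θ) = 0 := by
  rw [integral_finsetSum _ fun _ _ => Integrable.of_finite]
  simp [integral_const_mul, integral_noise]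

lemma sq_le_exp_add_exp_neg (x : ℝ) : x ^ 2 ≤ 2 * (Real.exp x + Real.exp (-x)) := by
  have h1 := Real.exp_pos x
  have h2 := Real.exp_pos (-x)
  rcases le_total 0 x with h | h
  · nlinarith [Real.quadratic_le_exp_of_nonneg h]
  · nlinarith [Real.quadratic_le_exp_of_nonneg (neg_nonneg.2 h)]

/-- Linear forms in the noise have second moment controlled by the squared norm of their
coefficients; the constant is not optimal, as the bound is read off the moment generating
function. -/
lemma integral_sq_sum_noise_le (θ : EuclideanSpace ℝ ι) (a : ι → ℝ) :
    ∫ y, (∑ i, a i * noise θ y i) ^ 2 ∂(dataLaw θ) ≤ 8 * ∑ i, a i ^ 2 := by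
  set s := ∑ i, a i ^ 2 with hs
  have hs0 : 0 ≤ s := Finset.sum_nonneg fun i _ => sq_nonneg (a i)
  rcases hs0.eq_or_lt with h0 | h0
  · have ha (i : ι) : a i = 0 := by
      have := (Finset.sum_eq_zero_iff_of_nonneg fun i _ => sq_nonneg (a i)).1 h0.symm i
        (Finset.mem_univ i)
      simpa using this
    simp [ha, hs0]
  -- normalise the linear form to unit variance proxy
  set r := (Real.sqrt s)⁻¹ with hr
  have hrs : r ^ 2 * s = 1 := by
    rw [hr, inv_pow, Real.sq_sqrt h0.le]; field_simp
  have hexp (ε : ℝ) (hε : ε ^ 2 = 1) :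
      ∫ y, Real.exp (ε * (r * ∑ i, a i * noise θ y i)) ∂(dataLaw θ) ≤ 2 := by
    have h := integral_exp_noise_le θ fun i => ε * r * a i
    have e1 : (∑ i, (ε * r * a i) ^ 2) = 1 := by
      simp_rw [mul_pow, hε, one_mul, ← Finset.mul_sum]; exact hrs
    rw [e1] at h
    have e2 : Real.exp (1 / 8) ≤ 2 := by
      have := Real.exp_bound_div_one_sub_of_interval (x := 1 / 8) (by norm_num) (by norm_num)
      norm_num at this ⊢
      linarith
    refine le_trans (le_of_eq ?_) (h.trans e2)
    refine integral_congr_ae (Filter.Eventually.of_forall fun y => ?_)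
    simp only [Finset.mul_sum]
    congr 1
    exact Finset.sum_congr rfl fun i _ => by ring
  have h2 : ∫ y, (r * ∑ i, a i * noise θ y i) ^ 2 ∂(dataLaw θ) ≤ 8 := by
    calc _ ≤ ∫ y, 2 * (Real.exp (1 * (r * ∑ i, a i * noise θ y i)) +
          Real.exp (-1 * (r * ∑ i, a i * noise θ y i))) ∂(dataLaw θ) := by
          refine integral_mono Integrable.of_finite Integrable.of_finite fun y => ?_
          simpa using sq_le_exp_add_exp_neg (r * ∑ i, a i * noise θ y i)
      _ ≤ 8 := by
          rw [integral_const_mul, integral_add Integrable.of_finite Integrable.of_finite]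
          linarith [hexp 1 (by norm_num), hexp (-1) (by norm_num)]
  simp_rw [mul_pow] at h2
  rw [integral_const_mul] at h2
  have : (∫ y, (∑ i, a i * noise θ y i) ^ 2 ∂(dataLaw θ)) * (r ^ 2 * s) ≤ 8 * s := by
    nlinarith
  rwa [hrs, mul_one] at this

/-- Maximal inequality for the noise summed over finitely many sets of bounded size. -/
lemma integral_sup'_sum_noise_le [DecidableEq ι] (θ : EuclideanSpace ℝ ι) {κ : Type*} (F : Finset κ)
    (hF : F.Nonempty) (D : κ → Finset ι) {v l : ℝ} (hD : ∀ k ∈ F, ((D k).card : ℝ) ≤ v)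
    (hl : 0 < l) :
    ∫ y, F.sup' hF (fun k => ∑ i ∈ D k, noise θ y i) ∂(dataLaw θ) ≤
      Real.log F.card / l + l * v / 8 := by
  have hN : (0 : ℝ) < F.card := by exact_mod_cast hF.card_pos
  -- `z ≤ b - 1 + exp (z - b)`, for the optimal `b`, replaces Jensen's inequality
  set b := Real.log F.card + l ^ 2 * v / 8 with hb
  have hsum (y : ι → Bool) (k : κ) : l * ∑ i ∈ D k, noise θ y i =
      ∑ i, (if i ∈ D k then l else 0) * noise θ y i := by
    simp [Finset.mul_sum, ite_mul, Finset.sum_ite_mem]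
  have hpt (y : ι → Bool) : l * F.sup' hF (fun k => ∑ i ∈ D k, noise θ y i) ≤
      b - 1 +
        ∑ k ∈ F, Real.exp (∑ i, (if i ∈ D k then l else 0) * noise θ y i) * Real.exp (-b) := by
    obtain ⟨k, hk, hmax⟩ := Finset.exists_mem_eq_sup' hF (fun k => ∑ i ∈ D k, noise θ y i)
    rw [hmax, hsum]
    have h1 := Real.add_one_le_exp ((∑ i, (if i ∈ D k then l else 0) * noise θ y i) - b)
    have h2 := Finset.single_le_sum
      (f := fun k => Real.exp (∑ i, (if i ∈ D k then l else 0) * noise θ y i) * Real.exp (-b))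
      (fun k _ => by positivity) hk
    simp only [← Real.exp_add, ← sub_eq_add_neg] at h2 ⊢
    linarith
  have hk (k : κ) (hk : k ∈ F) :
      ∫ y, Real.exp (∑ i, (if i ∈ D k then l else 0) * noise θ y i) * Real.exp (-b) ∂(dataLaw θ) ≤
        (F.card : ℝ)⁻¹ := by
    rw [integral_mul_const]
    have h := integral_exp_noise_le θ fun i => if i ∈ D k then l else 0
    have e : (∑ i, (if i ∈ D k then l else 0) ^ 2) = (D k).card * l ^ 2 := by
      simp [ite_pow, Finset.sum_ite_mem]
    rw [e] at h
    calc _ ≤ Real.exp (l ^ 2 * v / 8) * Real.exp (-b) := by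
          refine mul_le_mul_of_nonneg_right (h.trans (Real.exp_le_exp.2 ?_)) (Real.exp_pos _).le
          nlinarith [hD k hk, sq_nonneg l]
      _ = _ := by
          rw [← Real.exp_add, hb]
          ring_nf
          rw [Real.exp_neg, Real.exp_log hN]
  have hint := integral_mono (μ := dataLaw θ) Integrable.of_finite Integrable.of_finite hpt
  rw [integral_const_mul, integral_add Integrable.of_finite Integrable.of_finite,
    integral_finsetSum _ fun _ _ => Integrable.of_finite] at hint
  have h3 := Finset.sum_le_sum hk
  rw [Finset.sum_const, nsmul_eq_mul, mul_inv_cancel₀ hN.ne'] at h3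
  simp only [integral_const, probReal_univ, smul_eq_mul, one_mul] at hint
  have h4 : l * ∫ y, F.sup' hF (fun k => ∑ i ∈ D k, noise θ y i) ∂(dataLaw θ) ≤ b := by linarith
  calc _ = (l * ∫ y, F.sup' hF (fun k => ∑ i ∈ D k, noise θ y i) ∂(dataLaw θ)) / l := by
        field_simp
    _ ≤ b / l := by gcongr
    _ = _ := by rw [hb]; field_simp

/-- On `[-M, M]` the log-odds is a Lipschitz function of the success probability. -/
lemma sigmoid_expansive {M s t : ℝ} (hs : s ∈ Set.Icc (-M) M) (ht : t ∈ Set.Icc (-M) M) :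
    Real.sigmoid (-M) ^ 2 * |t - s| ≤ |Real.sigmoid t - Real.sigmoid s| := by
  wlog h : s ≤ t generalizing s t
  · rw [abs_sub_comm t, abs_sub_comm (Real.sigmoid t)]
    exact this ht hs (le_of_not_ge h)
  rw [abs_of_nonneg (sub_nonneg.2 h), abs_of_nonneg (sub_nonneg.2 (Real.sigmoid_le h))]
  refine Convex.mul_sub_le_image_sub_of_le_deriv (convex_Icc (-M) M)
    continuous_sigmoid.continuousOn differentiable_sigmoid.differentiableOn ?_ s hs t ht h
  intro x hx
  rw [interior_Icc] at hx
  rw [Real.deriv_sigmoid]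
  simp only [← Real.sigmoid_neg]
  rw [sq]
  exact mul_le_mul (Real.sigmoid_le hx.1.le) (Real.sigmoid_le (by linarith [hx.2]))
    (Real.sigmoid_nonneg _) (Real.sigmoid_nonneg _)

/-- It is enough to estimate the success probabilities: taking in each coordinate the log-odds in
`[-M, M]` whose probability is nearest to the estimate costs only a constant factor. -/
lemma minimaxRisk_le_of_estimator {M : ℝ} (hM : 0 < M) {K : Set (EuclideanSpace ℝ ι)}
    (hK : ∀ θ ∈ K, ∀ i, θ i ∈ Set.Icc (-M) M) (g : (ι → Bool) → ι → ℝ) {B : ℝ}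
    (hB : ∀ θ ∈ K, ∫ y, ∑ i, (g y i - Real.sigmoid (θ i)) ^ 2 ∂(dataLaw θ) ≤ B) :
    minimaxRisk K ≤ ENNReal.ofReal (4 / Real.sigmoid (-M) ^ 4 * B) := by
  have hex (x : ℝ) : ∃ t ∈ Set.Icc (-M) M, ∀ s ∈ Set.Icc (-M) M,
      |x - Real.sigmoid t| ≤ |x - Real.sigmoid s| := by
    obtain ⟨t, ht, hmin⟩ := (isCompact_Icc (a := -M) (b := M)).exists_isMinOn
      ⟨0, by constructor <;> linarith⟩ (f := fun t => |x - Real.sigmoid t|)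
      (by fun_prop)
    exact ⟨t, ht, fun s hs => hmin hs⟩
  choose τ hτ hmin using hex
  have hσ := Real.sigmoid_pos (-M)
  have hpt (x s : ℝ) (hs : s ∈ Set.Icc (-M) M) :
      (τ x - s) ^ 2 ≤ 4 / Real.sigmoid (-M) ^ 4 * (x - Real.sigmoid s) ^ 2 := by
    have h1 := sigmoid_expansive hs (hτ x)
    have h2 : |Real.sigmoid (τ x) - Real.sigmoid s| ≤ 2 * |x - Real.sigmoid s| := by
      have := abs_sub_le (Real.sigmoid (τ x)) x (Real.sigmoid s)
      rw [abs_sub_comm _ x] at this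
      linarith [hmin x s hs]
    have h3 := pow_le_pow_left₀ (by positivity) (h1.trans h2) 2
    rw [mul_pow, mul_pow, sq_abs, sq_abs] at h3
    rw [div_mul_eq_mul_div, le_div_iff₀ (by positivity)]
    nlinarith
  refine (iInf₂_le (fun y => WithLp.toLp 2 fun i => τ (g y i)) (measurable_of_finite _)).trans ?_
  refine iSup₂_le fun θ hθ => ?_
  rw [← ofReal_integral_eq_lintegral_ofReal Integrable.of_finite
    (Filter.Eventually.of_forall fun _ => by positivity)]
  refine ENNReal.ofReal_le_ofReal ?_
  calc _ ≤ ∫ y, 4 / Real.sigmoid (-M) ^ 4 * ∑ i, (g y i - Real.sigmoid (θ i)) ^ 2 ∂(dataLaw θ) := by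
        refine integral_mono Integrable.of_finite Integrable.of_finite fun y => ?_
        simp only [EuclideanSpace.norm_sq_eq, Finset.mul_sum]
        refine Finset.sum_le_sum fun i _ => ?_
        simpa using hpt (g y i) (θ i) (hK θ hθ i)
    _ ≤ _ := by
        rw [integral_const_mul]
        exact mul_le_mul_of_nonneg_left (hB θ hθ) (by positivity)

end Probability

/-! ### Assouad's lemma for Bernoulli laws -/

section LowerBound

/-- The vector which adds a bump of height `δ` to `base` on those blocks of the index set `S` that
are switched on by `ε`; the block of an index is given by `blk`. -/
noncomputable def bump {ι β : Type*} [DecidableEq ι] (base : ι → ℝ) (S : Finset ι) (blk : ι → β)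
    (δ : ℝ) (ε : β → Bool) : EuclideanSpace ℝ ι :=
  WithLp.toLp 2 fun i => base i + if i ∈ S ∧ ε (blk i) then δ else 0

@[simp]
lemma bump_apply {ι β : Type*} [DecidableEq ι] (base : ι → ℝ) (S : Finset ι) (blk : ι → β)
    (δ : ℝ) (ε : β → Bool) (i : ι) :
    bump base S blk δ ε i = base i + if i ∈ S ∧ ε (blk i) then δ else 0 := rfl

variable {ι : Type*} [Fintype ι]

/-- The Hellinger affinity of two Bernoulli laws given by their log-odds. -/
noncomputable def affinity (s t : ℝ) : ℝ :=
  ∑ b, Real.sqrt ((berLogOdds s).real {b} * (berLogOdds t).real {b})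

lemma affinity_self (t : ℝ) : affinity t t = 1 := by
  rw [affinity, Fintype.sum_bool, Real.sqrt_mul_self measureReal_nonneg,
    Real.sqrt_mul_self measureReal_nonneg, berLogOdds_real_true, berLogOdds_real_false]
  ring

lemma affinity_comm (s t : ℝ) : affinity s t = affinity t s := by
  simp only [affinity, mul_comm]

lemma one_sub_sq_div_four_le_affinity_sq (s t : ℝ) : 1 - (s - t) ^ 2 / 4 ≤ affinity s t ^ 2 := by
  wlog h : s ≤ t generalizing s t
  · rw [affinity_comm, show (s - t) ^ 2 = (t - s) ^ 2 by ring]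
    exact this t s (le_of_not_ge h)
  -- in terms of `u = exp (s / 2)` and `v = exp (t / 2)` the squared affinity is
  -- `(1 + u v)² / ((1 + u²) (1 + v²)) = 1 - (v - u)² / ((1 + u²) (1 + v²))`
  set u := Real.exp (s / 2) with hu
  set v := Real.exp (t / 2) with hv
  have hu0 : 0 < u := Real.exp_pos _
  have hv0 : 0 < v := Real.exp_pos _
  have hsig (x : ℝ) : Real.sigmoid x = Real.exp (x / 2) ^ 2 / (1 + Real.exp (x / 2) ^ 2) := by
    have e : Real.exp (-x) = (Real.exp (x / 2) ^ 2)⁻¹ := by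
      rw [← Real.exp_nat_mul, ← Real.exp_neg]; congr 1; push_cast; ring
    rw [Real.sigmoid_def, e]
    have := Real.exp_pos (x / 2)
    field_simp
    ring
  have hA : affinity s t = (1 + u * v) / Real.sqrt ((1 + u ^ 2) * (1 + v ^ 2)) := by
    have hD : 0 < (1 + u ^ 2) * (1 + v ^ 2) := by positivity
    rw [affinity, Fintype.sum_bool, berLogOdds_real_true, berLogOdds_real_true,
      berLogOdds_real_false, berLogOdds_real_false, hsig s, hsig t, ← hu, ← hv]
    have e1 : u ^ 2 / (1 + u ^ 2) * (v ^ 2 / (1 + v ^ 2)) =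
        (u * v) ^ 2 / ((1 + u ^ 2) * (1 + v ^ 2)) := by field_simp
    have e2 : (1 - u ^ 2 / (1 + u ^ 2)) * (1 - v ^ 2 / (1 + v ^ 2)) =
        1 / ((1 + u ^ 2) * (1 + v ^ 2)) := by field_simp; ring
    rw [e1, e2, Real.sqrt_div (by positivity), Real.sqrt_div (by positivity),
      Real.sqrt_sq (by positivity), Real.sqrt_one]
    ring
  have hvu : v - u ≤ v * ((t - s) / 2) := by
    have e : u = v * Real.exp (-((t - s) / 2)) := by
      rw [hu, hv, ← Real.exp_add]; congr 1; ring
    have := Real.add_one_le_exp (-((t - s) / 2))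
    nlinarith
  have huv : u ≤ v := Real.exp_le_exp.2 (by linarith)
  have hsq : (v - u) ^ 2 ≤ v ^ 2 * ((s - t) ^ 2 / 4) := by
    have := pow_le_pow_left₀ (sub_nonneg.2 huv) hvu 2
    nlinarith
  rw [hA, div_pow, Real.sq_sqrt (by positivity), le_div_iff₀ (by positivity)]
  have h3 : v ^ 2 * ((s - t) ^ 2 / 4) ≤ (1 + u ^ 2) * (1 + v ^ 2) * ((s - t) ^ 2 / 4) := by
    refine mul_le_mul_of_nonneg_right ?_ (by positivity)
    nlinarith [sq_nonneg u, sq_nonneg v, mul_nonneg (sq_nonneg u) (sq_nonneg v)]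
  nlinarith

lemma dataLaw_real_singleton (θ : EuclideanSpace ℝ ι) (y : ι → Bool) :
    (dataLaw θ).real {y} = ∏ i, (berLogOdds (θ i)).real {y i} := by
  simp [dataLaw, measureReal_def, Measure.pi_singleton, ENNReal.toReal_prod]

variable [DecidableEq ι]

lemma sum_dataLaw_real (θ : EuclideanSpace ℝ ι) : ∑ y, (dataLaw θ).real {y} = 1 := by
  rw [sum_measureReal_singleton]; simp

lemma sum_sqrt_dataLaw (θ η : EuclideanSpace ℝ ι) :
    ∑ y, Real.sqrt ((dataLaw θ).real {y} * (dataLaw η).real {y}) = ∏ i, affinity (θ i) (η i) := by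
  simp only [affinity, dataLaw_real_singleton, ← Finset.prod_mul_distrib]
  rw [Finset.prod_univ_sum, Fintype.piFinset_univ]
  refine Finset.sum_congr rfl fun y _ => ?_
  exact Real.sqrt_prod _ fun i _ => by positivity

/-- Le Cam's bound: the overlap of two laws is at least half of their squared affinity. -/
lemma half_sq_affinity_le_sum_min (θ η : EuclideanSpace ℝ ι) :
    (∏ i, affinity (θ i) (η i) ^ 2) / 2 ≤
      ∑ y, min ((dataLaw θ).real {y}) ((dataLaw η).real {y}) := by
  rw [Finset.prod_pow, ← sum_sqrt_dataLaw]
  have h1 := Finset.sum_sq_le_sum_mul_sum_of_sq_le_mul (Finset.univ : Finset (ι → Bool))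
    (r := fun y => Real.sqrt ((dataLaw θ).real {y} * (dataLaw η).real {y}))
    (f := fun y => min ((dataLaw θ).real {y}) ((dataLaw η).real {y}))
    (g := fun y => max ((dataLaw θ).real {y}) ((dataLaw η).real {y}))
    (fun y _ => le_min measureReal_nonneg measureReal_nonneg)
    (fun y _ => le_max_of_le_left measureReal_nonneg)
    (fun y _ => by rw [Real.sq_sqrt (by positivity), min_mul_max])
  have h2 : ∑ y, max ((dataLaw θ).real {y}) ((dataLaw η).real {y}) ≤ 2 := by
    calc _ ≤ ∑ y, ((dataLaw θ).real {y} + (dataLaw η).real {y}) :=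
          Finset.sum_le_sum fun y _ => max_le_add_of_nonneg measureReal_nonneg measureReal_nonneg
      _ = 2 := by
          rw [Finset.sum_add_distrib, sum_dataLaw_real, sum_dataLaw_real]; norm_num
  have h3 : 0 ≤ ∑ y, min ((dataLaw θ).real {y}) ((dataLaw η).real {y}) :=
    Finset.sum_nonneg fun y _ => le_min measureReal_nonneg measureReal_nonneg
  nlinarith

lemma integral_dataLaw (θ : EuclideanSpace ℝ ι) (f : (ι → Bool) → ℝ) :
    ∫ y, f y ∂(dataLaw θ) = ∑ y, (dataLaw θ).real {y} * f y := by
  rw [integral_fintype Integrable.of_finite]; simp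

/-- No estimator `f` can be close to `a` under the first law and to `b` under the second. -/
lemma two_point_bound (θ η : EuclideanSpace ℝ ι) (f : (ι → Bool) → ℝ) (a b : ℝ) :
    (a - b) ^ 2 / 4 * ∏ i, affinity (θ i) (η i) ^ 2 ≤
      ∫ y, (f y - a) ^ 2 ∂(dataLaw θ) + ∫ y, (f y - b) ^ 2 ∂(dataLaw η) := by
  rw [integral_dataLaw, integral_dataLaw, ← Finset.sum_add_distrib]
  have h := half_sq_affinity_le_sum_min θ η
  calc _ ≤ (a - b) ^ 2 / 2 * ∑ y, min ((dataLaw θ).real {y}) ((dataLaw η).real {y}) := by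
        nlinarith [sq_nonneg (a - b)]
    _ ≤ _ := by
        rw [Finset.mul_sum]
        refine Finset.sum_le_sum fun y _ => ?_
        have h1 := min_le_left ((dataLaw θ).real {y}) ((dataLaw η).real {y})
        have h2 := min_le_right ((dataLaw θ).real {y}) ((dataLaw η).real {y})
        have h0 : 0 ≤ min ((dataLaw θ).real {y}) ((dataLaw η).real {y}) :=
          le_min measureReal_nonneg measureReal_nonneg
        have h3 := mul_le_mul_of_nonneg_right h1 (sq_nonneg (f y - a))
        have h4 := mul_le_mul_of_nonneg_right h2 (sq_nonneg (f y - b))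
        nlinarith [mul_nonneg h0 (sq_nonneg ((f y - a) + (f y - b)))]

/-- Assouad's lemma for block perturbations: if the blocks are so small that the switch of a single
block cannot be detected, each coordinate of `S` contributes a multiple of `δ²` to the risk. -/
lemma le_minimaxRisk_of_bump {β : Type*} [Fintype β] [DecidableEq β]
    {K : Set (EuclideanSpace ℝ ι)} (base : ι → ℝ) (S : Finset ι) (blk : ι → β) {δ L : ℝ}
    (hK : ∀ ε : β → Bool, bump base S blk δ ε ∈ K)
    (hL : ∀ b, ((S.filter fun i => blk i = b).card : ℝ) ≤ L) (hδ : L * δ ^ 2 ≤ 2)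
    (hδ2 : δ ^ 2 ≤ 4) :
    ENNReal.ofReal (S.card * δ ^ 2 / 16) ≤ minimaxRisk K := by
  refine le_iInf₂ fun T _ => ?_
  set flip : β → (β → Bool) → (β → Bool) := fun b ε => Function.update ε b (!ε b) with hflip
  have hinv (b : β) : Function.Involutive (flip b) := by
    intro ε
    simp [hflip]
  have haff (ε : β → Bool) (b : β) :
      1 / 2 ≤ ∏ i, affinity (bump base S blk δ ε i) (bump base S blk δ (flip b ε) i) ^ 2 := by
    calc (1 / 2 : ℝ) ≤ 1 + (S.filter fun i => blk i = b).card * (-(δ ^ 2 / 4)) := by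
          nlinarith [hL b, sq_nonneg δ]
      _ ≤ (1 + -(δ ^ 2 / 4)) ^ (S.filter fun i => blk i = b).card :=
          one_add_mul_le_pow (by linarith) _
      _ = ∏ i, if i ∈ S.filter (fun i => blk i = b) then 1 - δ ^ 2 / 4 else 1 := by
          rw [Finset.prod_ite_mem, Finset.univ_inter, Finset.prod_const]; ring
      _ ≤ _ := by
          refine Finset.prod_le_prod (fun i _ => ?_) fun i _ => ?_
          · split_ifs <;> linarith
          · split_ifs with hi
            · refine le_trans (le_of_eq ?_) (one_sub_sq_div_four_le_affinity_sq _ _)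
              obtain ⟨hS, rfl⟩ := Finset.mem_filter.1 hi
              cases hε : ε (blk i) <;> simp [hflip, hS, hε]
            · refine le_of_eq ?_
              rw [bump_apply, bump_apply]
              by_cases hS : i ∈ S
              · have hb : blk i ≠ b := fun h => hi (Finset.mem_filter.2 ⟨hS, h⟩)
                simp [hflip, Function.update_of_ne hb, affinity_self]
              · simp [hS, affinity_self]
  set r : (β → Bool) → ι → ℝ := fun ε i =>
    ∫ y, (T y i - bump base S blk δ ε i) ^ 2 ∂(dataLaw (bump base S blk δ ε)) with hr
  have hpair (ε : β → Bool) (i : ι) (hi : i ∈ S) : δ ^ 2 / 8 ≤ r ε i + r (flip (blk i) ε) i := by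
    have h := two_point_bound (bump base S blk δ ε) (bump base S blk δ (flip (blk i) ε))
      (fun y => T y i) (bump base S blk δ ε i) (bump base S blk δ (flip (blk i) ε) i)
    have e : (bump base S blk δ ε i - bump base S blk δ (flip (blk i) ε) i) ^ 2 = δ ^ 2 := by
      cases hε : ε (blk i) <;> simp [hflip, hi, hε]
    rw [e] at h
    refine le_trans ?_ h
    nlinarith [haff ε (blk i), sq_nonneg δ]
  have hsum (i : ι) (hi : i ∈ S) : ∑ _ε : β → Bool, δ ^ 2 / 16 ≤ ∑ ε, r ε i := by
    have h1 : ∑ ε, r (flip (blk i) ε) i = ∑ ε, r ε i :=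
      Equiv.sum_comp (hinv (blk i)).toPerm fun ε => r ε i
    have h2 := Finset.sum_le_sum fun ε (_ : ε ∈ Finset.univ) => hpair ε i hi
    rw [Finset.sum_add_distrib, h1] at h2
    have h3 : ∑ _ε : β → Bool, δ ^ 2 / 8 = 2 * ∑ _ε : β → Bool, δ ^ 2 / 16 := by
      rw [Finset.mul_sum]; exact Finset.sum_congr rfl fun _ _ => by ring
    linarith
  obtain ⟨ε, -, hε⟩ : ∃ ε ∈ (Finset.univ : Finset (β → Bool)),
      (S.card * δ ^ 2 / 16 : ℝ) ≤ ∑ i ∈ S, r ε i := by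
    refine Finset.exists_le_of_sum_le Finset.univ_nonempty ?_
    rw [Finset.sum_comm]
    refine le_trans (le_of_eq ?_) (Finset.sum_le_sum hsum)
    simp only [Finset.sum_const, nsmul_eq_mul]
    ring
  refine le_trans ?_ (le_iSup₂ (bump base S blk δ ε) (hK ε))
  rw [← ofReal_integral_eq_lintegral_ofReal Integrable.of_finite
    (Filter.Eventually.of_forall fun _ => by positivity)]
  refine ENNReal.ofReal_le_ofReal (hε.trans ?_)
  simp only [EuclideanSpace.norm_sq_eq, Real.norm_eq_abs, sq_abs]
  rw [integral_finsetSum _ fun _ _ => Integrable.of_finite]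
  exact Finset.sum_le_sum_of_subset_of_nonneg (Finset.subset_univ _)
    fun i _ _ => integral_nonneg fun _ => sq_nonneg _

end LowerBound

/-! ### Monotone vectors on the lattice and lower bounds -/

section Lattice

variable {q m : ℕ}

lemma latticePoint_mono : Monotone (latticePoint (q := q) (m := m)) := by
  intro k l h j
  refine Subtype.mk_le_mk.2 ?_
  have : ((k j : ℕ) : ℝ) ≤ (l j : ℕ) := by exact_mod_cast h j
  gcongr

lemma mem_Icc_of_mem_evaluations {a b : ℝ} {θ : EuclideanSpace ℝ (Fin q → Fin m)}
    (h : θ ∈ evaluations q m a b) (k : Fin q → Fin m) : θ k ∈ Set.Icc a b := by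
  obtain ⟨f, hf, hθ⟩ := h
  rw [hθ]
  exact hf.1 _

lemma monotone_of_mem_evaluations {a b : ℝ} {θ : EuclideanSpace ℝ (Fin q → Fin m)}
    (h : θ ∈ evaluations q m a b) : Monotone (fun k => θ k) := by
  obtain ⟨f, hf, hθ⟩ := h
  intro k l hkl
  simp only [hθ]
  exact (nondecreasingInEachVariable_iff_monotone f).1 hf.2 (latticePoint_mono hkl)

/-- A monotone vector on the lattice is the restriction of a monotone function on the cube: compose
it with rounding up to the lattice. -/
lemma mem_evaluations_of_monotone (hm : 1 ≤ m) {a b : ℝ} {θ : EuclideanSpace ℝ (Fin q → Fin m)}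
    (hab : ∀ k, θ k ∈ Set.Icc a b) (hmono : Monotone (fun k => θ k)) :
    θ ∈ evaluations q m a b := by
  have hlt (z : unitInterval) : ⌈(m : ℝ) * z⌉₊ - 1 < m := by
    have : ⌈(m : ℝ) * z⌉₊ ≤ m := Nat.ceil_le.2 (by
      have := z.2.2
      have : (0 : ℝ) ≤ m := by positivity
      nlinarith)
    omega
  refine ⟨fun z => θ fun j => ⟨⌈(m : ℝ) * z j⌉₊ - 1, hlt (z j)⟩, ⟨fun z => hab _, ?_⟩, ?_⟩
  · rw [nondecreasingInEachVariable_iff_monotone]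
    intro z w h
    refine hmono fun j => Fin.mk_le_mk.2 (Nat.sub_le_sub_right (Nat.ceil_mono ?_) 1)
    have : ((z j : unitInterval) : ℝ) ≤ w j := h j
    gcongr
  · intro k
    refine congrArg (fun k => θ k) (funext fun j => Fin.ext ?_)
    have hm' : (m : ℝ) ≠ 0 := by positivity
    have e : (m : ℝ) * ((latticePoint k j : unitInterval) : ℝ) = ((k j + 1 : ℕ) : ℝ) := by
      simp only [latticePoint]
      push_cast
      field_simp
    simp only [e, Nat.ceil_natCast]
    simp

lemma sum_lt_sum_of_lattice_lt {x y : Fin q → Fin m} (h : x < y) :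
    ∑ j, (x j : ℕ) < ∑ j, (y j : ℕ) := by
  obtain ⟨hle, j, hj⟩ := Pi.lt_def.1 h
  exact Finset.sum_lt_sum (fun i _ => hle i) ⟨j, Finset.mem_univ _, hj⟩

/-- Pigeonhole: some layer of constant coordinate sum has at least the average size. -/
lemma exists_large_layer (hq : 1 ≤ q) (hm : 1 ≤ m) :
    ∃ s : ℕ, (m : ℝ) ^ (q - 1) / q ≤
      ((Finset.univ.filter fun x : Fin q → Fin m => ∑ j, (x j : ℕ) = s).card : ℝ) := by
  have hmaps : ∀ x ∈ (Finset.univ : Finset (Fin q → Fin m)),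
      ∑ j, (x j : ℕ) ∈ Finset.range (q * m) := by
    intro x _
    rw [Finset.mem_range]
    have : Nonempty (Fin q) := ⟨⟨0, hq⟩⟩
    calc ∑ j, (x j : ℕ) < ∑ _j : Fin q, m :=
          Finset.sum_lt_sum_of_nonempty Finset.univ_nonempty fun j _ => (x j).2
      _ = q * m := by simp
  have hq' : (0 : ℝ) < q := by exact_mod_cast hq
  have hm' : (0 : ℝ) < m := by exact_mod_cast hm
  obtain ⟨s, -, hs⟩ := Finset.exists_le_card_fiber_of_nsmul_le_card_of_maps_to
    (M := ℝ) (b := (m : ℝ) ^ (q - 1) / q) hmaps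
    (Finset.nonempty_range_iff.2 (by positivity)) (by
      rw [nsmul_eq_mul, Finset.card_range, Finset.card_univ, Fintype.card_fun, Fintype.card_fin,
        Fintype.card_fin]
      push_cast
      obtain ⟨q, rfl⟩ : ∃ r, q = r + 1 := ⟨q - 1, by omega⟩
      rw [Nat.add_sub_cancel, pow_succ]
      refine le_of_eq ?_
      field_simp)
  exact ⟨s, hs⟩

/-- In dimension `q` the vectors that are constant below and above an antichain and arbitrary on it
are monotone, so the risk is at least of the order of the size of the largest layer. -/
lemma le_minimaxRisk_evaluations (hq : 1 ≤ q) (hm : 1 ≤ m) {M : ℝ} (hM : 0 < M) :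
    ENNReal.ofReal (min M 1 ^ 2 / (16 * q) * (m : ℝ) ^ (q - 1)) ≤
      minimaxRisk (evaluations q m (-M) M) := by
  obtain ⟨s, hs⟩ := exists_large_layer hq hm
  set δ := min M 1
  have hδ0 : 0 ≤ δ := le_min hM.le zero_le_one
  have hδM : δ ≤ M := min_le_left _ _
  have hδ1 : δ ^ 2 ≤ 1 := pow_le_one₀ hδ0 (min_le_right _ _)
  set S := Finset.univ.filter fun x : Fin q → Fin m => ∑ j, (x j : ℕ) = s with hS
  refine le_trans (ENNReal.ofReal_le_ofReal ?_) (le_minimaxRisk_of_bump (δ := δ) (L := 1)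
    (fun x : Fin q → Fin m =>
      if ∑ j, (x j : ℕ) < s then -M else if s < ∑ j, (x j : ℕ) then M else 0)
    S id (fun ε => mem_evaluations_of_monotone hm (fun k => ?_) fun x y hxy => ?_) (fun b => ?_)
    (by linarith) (by linarith))
  · have hq' : (0 : ℝ) < q := by exact_mod_cast hq
    calc _ = (m : ℝ) ^ (q - 1) / q * (δ ^ 2 / 16) := by field_simp
      _ ≤ S.card * (δ ^ 2 / 16) := by gcongr
      _ = _ := by ring
  · rw [bump_apply, hS]
    rcases lt_trichotomy (∑ j, (k j : ℕ)) s with h | h | h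
    · simp [h, h.ne, hM.le]
    · simp only [h, lt_irrefl, if_false, zero_add, Finset.mem_filter, Finset.mem_univ, true_and]
      split_ifs <;> constructor <;> linarith
    · simp [h, h.ne', h.not_gt, hM.le]
  · rcases hxy.eq_or_lt with rfl | hlt
    · exact le_rfl
    have hr := sum_lt_sum_of_lattice_lt hlt
    simp only [bump_apply, hS, Finset.mem_filter, Finset.mem_univ, true_and]
    rcases lt_trichotomy (∑ j, (x j : ℕ)) s with h | h | h
    · rcases lt_trichotomy (∑ j, (y j : ℕ)) s with h' | h' | h'
      · simp [h, h.ne, h', h'.ne]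
      · simp only [h, h.ne, h', lt_irrefl, if_true, if_false, true_and, false_and]
        split_ifs <;> linarith
      · simp [h, h.ne, h', h'.ne', h'.not_gt, hM.le]
    · have h' : s < ∑ j, (y j : ℕ) := h ▸ hr
      simp only [h, h', h'.ne', h'.not_gt, lt_irrefl, if_true, if_false, true_and, false_and]
      split_ifs <;> linarith
    · have h' := h.trans hr
      simp [h, h.ne', h.not_gt, h', h'.ne', h'.not_gt]
  · have : (S.filter fun i => id i = b).card ≤ 1 :=
      Finset.card_le_one.2 fun x hx y hy => by simp at hx hy; rw [hx.2, hy.2]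
    exact_mod_cast this

lemma card_block_le {m L B : ℕ} [NeZero B] (hL : 0 < L) (b : Fin B) :
    (((Finset.univ.filter fun x : Fin 1 → Fin m => (x 0 : ℕ) < L * B).filter
      fun x => Fin.ofNat B ((x 0 : ℕ) / L) = b).card) ≤ L := by
  refine (Finset.card_le_card_of_injOn (t := Finset.range L) (fun x => (x 0 : ℕ) % L)
    (fun x _ => by simpa using Nat.mod_lt _ hL) ?_).trans_eq (Finset.card_range L)
  intro x hx y hy hxy
  -- two elements of a block have the same quotient by `L`
  have hquot : ∀ z ∈ ((Finset.univ.filter fun x : Fin 1 → Fin m => (x 0 : ℕ) < L * B).filter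
      fun x => Fin.ofNat B ((x 0 : ℕ) / L) = b), (z 0 : ℕ) / L = b := by
    intro z hz
    obtain ⟨h1, h2⟩ := Finset.mem_filter.1 hz
    rw [← h2, Fin.val_ofNat, Nat.mod_eq_of_lt (Nat.div_lt_of_lt_mul (Finset.mem_filter.1 h1).2)]
  have h : (x 0 : ℕ) = y 0 := by
    rw [← Nat.div_add_mod (x 0 : ℕ) L, ← Nat.div_add_mod (y 0 : ℕ) L, hquot x hx, hquot y hy]
    exact congrArg _ hxy
  funext j
  rw [Subsingleton.elim j 0]
  exact Fin.ext h

set_option maxHeartbeats 400000 in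
/-- In dimension one the risk is at least of order `m ^ (1 / 3)`: about `m ^ (1 / 3)` blocks of
length `m ^ (2 / 3)` carry independent jumps of height `m ^ (-1 / 3)`. -/
lemma le_minimaxRisk_evaluations_one {m : ℕ} (hm : 1 ≤ m) {M : ℝ} (hM : 0 < M) :
    ENNReal.ofReal (min M 1 ^ 2 / 128 * (m : ℝ) ^ (1 / 3 : ℝ)) ≤
      minimaxRisk (evaluations 1 m (-M) M) := by
  set r := (m : ℝ) ^ (1 / 3 : ℝ) with hr
  have hm1 : (1 : ℝ) ≤ m := by exact_mod_cast hm
  have hr1 : 1 ≤ r := Real.one_le_rpow hm1 (by norm_num)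
  have hr3 : r ^ 3 = m := by
    rw [hr, ← Real.rpow_natCast, ← Real.rpow_mul (by positivity)]; norm_num
  set κ := min M 1
  have hκ0 : 0 < κ := lt_min hM zero_lt_one
  have hκM : κ ≤ M := min_le_left _ _
  have hκ1 : κ ^ 2 ≤ 1 := pow_le_one₀ hκ0.le (min_le_right _ _)
  -- `B` blocks of length `L`, with jumps of height `δ = κ / B`, so that `L * δ ^ 2 ≤ 1`
  set B := ⌈r⌉₊ with hB
  have hBr : r ≤ B := Nat.le_ceil r
  have hB2 : (B : ℝ) ≤ 2 * r := by have := Nat.ceil_lt_add_one (zero_le_one.trans hr1); linarith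
  have hB0 : 0 < B := Nat.ceil_pos.2 (by linarith)
  have hBm : B ≤ m := Nat.ceil_le.2 (by
    nlinarith [mul_nonneg (sub_nonneg.2 hr1) (by linarith : 0 ≤ r)])
  set L := m / B with hL
  have hL0 : 0 < L := Nat.div_pos hBm hB0
  have hLB : L * B ≤ m := Nat.div_mul_le_self m B
  have hLB2 : m < (L + 1) * B := by
    rw [add_one_mul]; exact Nat.lt_div_mul_add hB0
  have hBpos : (0 : ℝ) < B := by exact_mod_cast hB0
  set δ := κ / B with hδ
  have hδ0 : 0 < δ := by positivity
  have hδB : δ * B = κ := by rw [hδ]; field_simp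
  have hLB' : (L : ℝ) * B ≤ m := by exact_mod_cast hLB
  have hLδ : (L : ℝ) * δ ^ 2 ≤ 2 := by
    have h1 : (L : ℝ) * δ ^ 2 * (B : ℝ) ^ 2 ≤ (B : ℝ) ^ 2 := by
      calc (L : ℝ) * δ ^ 2 * (B : ℝ) ^ 2 = (L : ℝ) * κ ^ 2 := by rw [← hδB]; ring
        _ ≤ (L : ℝ) * 1 := by gcongr
        _ ≤ (B : ℝ) ^ 2 := by
          have : (L : ℝ) * r ≤ r ^ 2 * r := by
            calc (L : ℝ) * r ≤ L * B := by gcongr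
              _ ≤ r ^ 2 * r := by rw [← pow_succ, hr3]; exact hLB'
          have := le_of_mul_le_mul_right this (by linarith)
          nlinarith
    have := le_of_mul_le_mul_right (h1.trans_eq (one_mul _).symm) (by positivity)
    linarith
  have hδ1 : δ ≤ 1 := by
    rw [hδ, div_le_one hBpos]
    have : (1 : ℝ) ≤ B := by exact_mod_cast hB0
    exact (min_le_right _ _).trans this
  have : NeZero B := ⟨hB0.ne'⟩
  set S := Finset.univ.filter fun x : Fin 1 → Fin m => (x 0 : ℕ) < L * B with hS
  have hdiv (x : Fin 1 → Fin m) (hx : (x 0 : ℕ) < L * B) : (x 0 : ℕ) / L < B :=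
    Nat.div_lt_of_lt_mul hx
  have hScard : L * B ≤ S.card := by
    have := Finset.card_le_card_of_injOn (s := (Finset.univ : Finset (Fin (L * B)))) (t := S)
      (fun i => fun _ => ⟨i, i.2.trans_le hLB⟩) (by intro i _; simp [hS])
      (by
        intro i _ j _ hij
        have := congrFun hij 0
        simpa [Fin.ext_iff] using this)
    simpa using this
  refine le_trans (ENNReal.ofReal_le_ofReal ?_) (le_minimaxRisk_of_bump (δ := δ) (L := L)
    (fun x : Fin 1 → Fin m => if (x 0 : ℕ) < L * B then δ * ((x 0 : ℕ) / L : ℕ) else M)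
    S (fun x => Fin.ofNat B ((x 0 : ℕ) / L))
    (fun ε => mem_evaluations_of_monotone hm (fun x => ?_) fun x y hxy => ?_) (fun b => ?_)
    hLδ (by nlinarith))
  · have h1 : (m : ℝ) ≤ 2 * (L * B) := by
      have : m ≤ 2 * (L * B) := by nlinarith
      exact_mod_cast this
    have h2 : (L * B : ℝ) ≤ S.card := by exact_mod_cast hScard
    have h3 : (r ^ 3) * κ ^ 2 ≤ 2 * (S.card * δ ^ 2) * (4 * r ^ 2) := by
      calc (r ^ 3) * κ ^ 2 ≤ (2 * S.card) * κ ^ 2 := by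
            gcongr; rw [hr3]; linarith
        _ = 2 * (S.card * δ ^ 2) * B ^ 2 := by rw [← hδB]; ring
        _ ≤ 2 * (S.card * δ ^ 2) * (4 * r ^ 2) := by
            gcongr; nlinarith
    have h4 : r * κ ^ 2 * r ^ 2 ≤ 8 * (S.card * δ ^ 2) * r ^ 2 := by linarith
    have h5 := le_of_mul_le_mul_right h4 (by positivity)
    linarith
  · rw [bump_apply, hS]
    by_cases h : (x 0 : ℕ) < L * B
    · have h1 : (((x 0 : ℕ) / L : ℕ) : ℝ) + 1 ≤ B := by exact_mod_cast hdiv x h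
      have h2 : δ * (((x 0 : ℕ) / L : ℕ) : ℝ) + δ ≤ M := by
        have := mul_le_mul_of_nonneg_left h1 hδ0.le
        linarith
      have h3 : 0 ≤ δ * (((x 0 : ℕ) / L : ℕ) : ℝ) := by positivity
      simp only [h, if_true, Finset.mem_filter, Finset.mem_univ, true_and]
      split_ifs <;> constructor <;> linarith
    · simp [h, hM.le]
  · have hxy0 : (x 0 : ℕ) ≤ y 0 := hxy 0
    simp only [bump_apply, hS, Finset.mem_filter, Finset.mem_univ, true_and]
    by_cases hx : (x 0 : ℕ) < L * B
    · have h1 : (((x 0 : ℕ) / L : ℕ) : ℝ) + 1 ≤ B := by exact_mod_cast hdiv x hx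
      have h2 : δ * (((x 0 : ℕ) / L : ℕ) : ℝ) + δ ≤ M := by
        have := mul_le_mul_of_nonneg_left h1 hδ0.le
        linarith
      by_cases hy : (y 0 : ℕ) < L * B
      · simp only [hx, hy, if_true, true_and]
        rcases (Nat.div_le_div_right (c := L) hxy0).eq_or_lt with h | h
        · rw [h]
        · have h4 : (((x 0 : ℕ) / L : ℕ) : ℝ) + 1 ≤ ((y 0 : ℕ) / L : ℕ) := by exact_mod_cast h
          have h5 := mul_le_mul_of_nonneg_left h4 hδ0.le
          rw [mul_add, mul_one] at h5
          split_ifs <;> linarith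
      · simp only [hx, hy, if_true, true_and, if_false, false_and, add_zero]
        split_ifs <;> linarith
    · have hy : ¬ (y 0 : ℕ) < L * B := fun h => hx (hxy0.trans_lt h)
      simp [hx, hy]
  · exact_mod_cast card_block_le hL0 b

end Lattice

/-! ### The dyadic max-min estimator of a monotone sequence -/

section DyadicMinMax

/-- The average of `Y` over the window `[i - 2 ^ l, i + 2 ^ k]`. -/
noncomputable def windowMean (Y : ℤ → ℝ) (i : ℤ) (l k : ℕ) : ℝ :=
  (∑ j ∈ Finset.Icc (i - 2 ^ l) (i + 2 ^ k), Y j) / (2 ^ l + 2 ^ k + 1)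

/-- The max-min estimator of a monotone sequence, over windows with dyadic arms of length at most
`2 ^ K`. -/
noncomputable def dyadicMaxMin (K : ℕ) (Y : ℤ → ℝ) (i : ℤ) : ℝ :=
  (Finset.range (K + 1)).sup' Finset.nonempty_range_add_one fun l =>
    (Finset.range (K + 1)).inf' Finset.nonempty_range_add_one fun k => windowMean Y i l k

lemma card_window (i : ℤ) (l k : ℕ) :
    ((Finset.Icc (i - 2 ^ l) (i + 2 ^ k)).card : ℝ) = 2 ^ l + 2 ^ k + 1 := by
  rw [Int.card_Icc]
  have : (i + 2 ^ k + 1 - (i - 2 ^ l)).toNat = 2 ^ l + 2 ^ k + 1 := by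
    zify
    rw [Int.toNat_of_nonneg (by have : (0 : ℤ) < 2 ^ k := by positivity
                                have : (0 : ℤ) < 2 ^ l := by positivity
                                linarith)]
    ring
  rw [this]
  push_cast
  rfl

lemma windowMean_mono {Y Z : ℤ → ℝ} {i : ℤ} {l k : ℕ}
    (h : ∀ j ∈ Finset.Icc (i - 2 ^ l) (i + 2 ^ k), Y j ≤ Z j) :
    windowMean Y i l k ≤ windowMean Z i l k := by
  unfold windowMean
  gcongr with j hj
  exact h j hj

lemma windowMean_const_add (c : ℝ) (Y : ℤ → ℝ) (i : ℤ) (l k : ℕ) :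
    windowMean (fun j => c + Y j) i l k = c + windowMean Y i l k := by
  unfold windowMean
  rw [Finset.sum_add_distrib, Finset.sum_const, nsmul_eq_mul, card_window, add_div,
    mul_div_cancel_left₀ _ (by positivity)]

lemma sum_window_eq_left (ξ : ℤ → ℝ) (i : ℤ) (l k : ℕ) :
    ∑ j ∈ Finset.Icc (i - 2 ^ l) (i + 2 ^ k), ξ j =
      ∑ j ∈ Finset.Icc i (i + 2 ^ k), ξ j + ∑ j ∈ Finset.Ico (i - 2 ^ l) i, ξ j := by
  have hl : (0 : ℤ) < 2 ^ l := by positivity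
  have hk : (0 : ℤ) < 2 ^ k := by positivity
  rw [← Finset.sum_union (Finset.disjoint_left.2 fun j h1 h2 => by
    simp only [Finset.mem_Icc, Finset.mem_Ico] at h1 h2; omega)]
  congr 1
  ext j
  simp only [Finset.mem_Icc, Finset.mem_Ico, Finset.mem_union]
  omega

lemma sum_window_eq_right (ξ : ℤ → ℝ) (i : ℤ) (l k : ℕ) :
    ∑ j ∈ Finset.Icc (i - 2 ^ l) (i + 2 ^ k), ξ j =
      ∑ j ∈ Finset.Icc (i - 2 ^ l) i, ξ j + ∑ j ∈ Finset.Ioc i (i + 2 ^ k), ξ j := by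
  have hl : (0 : ℤ) < 2 ^ l := by positivity
  have hk : (0 : ℤ) < 2 ^ k := by positivity
  rw [← Finset.sum_union (Finset.disjoint_left.2 fun j h1 h2 => by
    simp only [Finset.mem_Icc, Finset.mem_Ioc] at h1 h2; omega)]
  congr 1
  ext j
  simp only [Finset.mem_Icc, Finset.mem_Ioc, Finset.mem_union]
  omega

lemma abs_sum_div_le {a b u v : ℝ} (hu : 0 < u) (hv : 0 < v) :
    |(a + b) / (v + u + 1)| ≤ |a| / u + |b| / (v + u) := by
  rw [abs_div, abs_of_pos (show 0 < v + u + 1 by linarith)]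
  calc |a + b| / (v + u + 1) ≤ (|a| + |b|) / (v + u + 1) := by gcongr; exact abs_add_le a b
    _ = |a| / (v + u + 1) + |b| / (v + u + 1) := add_div _ _ _
    _ ≤ _ := add_le_add (div_le_div_of_nonneg_left (abs_nonneg a) hu (by linarith))
        (div_le_div_of_nonneg_left (abs_nonneg b) (by linarith) (by linarith))

/-- Choosing the right arm `2 ^ k` in the inner minimum bounds the estimator from above by the drift
over that arm and the noise in the windows it takes part in. -/
lemma dyadicMaxMin_sub_le {K k : ℕ} (hk : k ≤ K) {p ξ : ℤ → ℝ} (hp : Monotone p) (i : ℤ) :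
    ∃ l ∈ Finset.range (K + 1), dyadicMaxMin K (fun j => p j + ξ j) i - p i ≤
      (p (i + 2 ^ k) - p i) + |∑ j ∈ Finset.Icc i (i + 2 ^ k), ξ j| / 2 ^ k +
        |∑ j ∈ Finset.Ico (i - 2 ^ l) i, ξ j| / (2 ^ l + 2 ^ k) := by
  obtain ⟨l, hl, hmax⟩ := Finset.exists_mem_eq_sup' (s := Finset.range (K + 1))
    Finset.nonempty_range_add_one fun l => (Finset.range (K + 1)).inf'
      Finset.nonempty_range_add_one fun k => windowMean (fun j => p j + ξ j) i l k
  refine ⟨l, hl, ?_⟩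
  have h1 : dyadicMaxMin K (fun j => p j + ξ j) i ≤ windowMean (fun j => p j + ξ j) i l k := by
    rw [dyadicMaxMin, hmax]
    exact Finset.inf'_le _ (Finset.mem_range.2 (by omega))
  have h2 : windowMean (fun j => p j + ξ j) i l k ≤ p (i + 2 ^ k) + windowMean ξ i l k := by
    rw [← windowMean_const_add]
    refine windowMean_mono fun j hj => ?_
    linarith [hp (Finset.mem_Icc.1 hj).2]
  have h3 : windowMean ξ i l k ≤ |∑ j ∈ Finset.Icc i (i + 2 ^ k), ξ j| / 2 ^ k +
        |∑ j ∈ Finset.Ico (i - 2 ^ l) i, ξ j| / (2 ^ l + 2 ^ k) := by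
    rw [windowMean, sum_window_eq_left]
    exact (le_abs_self _).trans (abs_sum_div_le (by positivity) (by positivity))
  linarith

/-- The bound from below, by choosing the left arm `2 ^ l` in the outer maximum. -/
lemma sub_dyadicMaxMin_le {K l : ℕ} (hl : l ≤ K) {p ξ : ℤ → ℝ} (hp : Monotone p) (i : ℤ) :
    ∃ k ∈ Finset.range (K + 1), p i - dyadicMaxMin K (fun j => p j + ξ j) i ≤
      (p i - p (i - 2 ^ l)) + |∑ j ∈ Finset.Icc (i - 2 ^ l) i, ξ j| / 2 ^ l +
        |∑ j ∈ Finset.Ioc i (i + 2 ^ k), ξ j| / (2 ^ k + 2 ^ l) := by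
  obtain ⟨k, hk, hmin⟩ := Finset.exists_mem_eq_inf' (s := Finset.range (K + 1))
    Finset.nonempty_range_add_one fun k => windowMean (fun j => p j + ξ j) i l k
  refine ⟨k, hk, ?_⟩
  have h1 : windowMean (fun j => p j + ξ j) i l k ≤ dyadicMaxMin K (fun j => p j + ξ j) i := by
    rw [← hmin, dyadicMaxMin]
    exact Finset.le_sup' (fun l => (Finset.range (K + 1)).inf'
      Finset.nonempty_range_add_one fun k => windowMean (fun j => p j + ξ j) i l k)
      (Finset.mem_range.2 (by omega))
  have h2 : p (i - 2 ^ l) + windowMean ξ i l k ≤ windowMean (fun j => p j + ξ j) i l k := by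
    rw [← windowMean_const_add]
    refine windowMean_mono fun j hj => ?_
    linarith [hp (Finset.mem_Icc.1 hj).1]
  have h3 : -windowMean ξ i l k ≤ |∑ j ∈ Finset.Icc (i - 2 ^ l) i, ξ j| / 2 ^ l +
        |∑ j ∈ Finset.Ioc i (i + 2 ^ k), ξ j| / (2 ^ k + 2 ^ l) := by
    rw [windowMean, sum_window_eq_right, add_comm ((2 : ℝ) ^ l)]
    exact (neg_le_abs _).trans (abs_sum_div_le (by positivity) (by positivity))
  linarith

/-- The variances of the far arms, weighted by the window lengths, telescope to `O(1 / w)`. -/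
lemma sum_two_pow_div_sq_le {w : ℝ} (hw : 0 < w) (n : ℕ) :
    ∑ l ∈ Finset.range n, (2 : ℝ) ^ l / (2 ^ l + w) ^ 2 ≤ 2 / w := by
  have h : ∑ l ∈ Finset.range n, (2 : ℝ) ^ l / (2 ^ l + w) ^ 2 ≤
      ∑ l ∈ Finset.range n, (-2 / (2 ^ (l + 1) + w) - -2 / (2 ^ l + w)) := by
    refine Finset.sum_le_sum fun l _ => ?_
    have h0 : (0 : ℝ) < 2 ^ l := by positivity
    rw [pow_succ (2 : ℝ) l, div_sub_div _ _ (by positivity) (by positivity),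
      div_le_div_iff₀ (by positivity) (by positivity)]
    have : 0 ≤ (2 : ℝ) ^ l * (2 ^ l + w) * w := by positivity
    nlinarith
  refine h.trans ?_
  rw [Finset.sum_range_sub fun l => -2 / ((2 : ℝ) ^ l + w)]
  have h1 : (2 : ℝ) / (2 ^ 0 + w) ≤ 2 / w := by gcongr; linarith [pow_zero (2 : ℝ)]
  have h2 : (0 : ℝ) ≤ 2 / (2 ^ n + w) := by positivity
  rw [neg_div, neg_div]
  linarith

section Risk

variable {Ω : Type*} [Finite Ω] [MeasurableSpace Ω] [MeasurableSingletonClass Ω] {μ : Measure Ω}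
  [IsProbabilityMeasure μ]

/-- Second moment of the positive part of an error that is dominated by a drift `D`, a near-arm
noise `S` and the noise `R l` of one unspecified far arm: the maximum over `l` is replaced by a sum,
which the window lengths in the denominators keep of order `2 ^ (-k)`. -/
lemma integral_sq_posPart_le {K k : ℕ} {V D : ℝ} (hV : 0 ≤ V) (hD : 0 ≤ D) {x S : Ω → ℝ}
    {R : ℕ → Ω → ℝ}
    (hS : ∫ ω, S ω ^ 2 ∂μ ≤ V * (2 ^ k + 1)) (hR : ∀ l, ∫ ω, R l ω ^ 2 ∂μ ≤ V * 2 ^ l)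
    (hx : ∀ ω, ∃ l ∈ Finset.range (K + 1), x ω ≤ D + |S ω| / 2 ^ k + |R l ω| / (2 ^ l + 2 ^ k)) :
    ∫ ω, max (x ω) 0 ^ 2 ∂μ ≤ (12 * V + 3) * (D ^ 2 + 1 / 2 ^ k) := by
  have hpt (ω : Ω) : max (x ω) 0 ^ 2 ≤ 3 * (D ^ 2 + S ω ^ 2 / (2 ^ k) ^ 2 +
      ∑ l ∈ Finset.range (K + 1), R l ω ^ 2 / (2 ^ l + 2 ^ k) ^ 2) := by
    obtain ⟨l, hl, h⟩ := hx ω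
    have h1 : max (x ω) 0 ≤ D + |S ω| / 2 ^ k + |R l ω| / (2 ^ l + 2 ^ k) :=
      max_le h (by positivity)
    have h2 := pow_le_pow_left₀ (le_max_right _ _) h1 2
    have h3 : R l ω ^ 2 / ((2 : ℝ) ^ l + 2 ^ k) ^ 2 ≤
        ∑ l ∈ Finset.range (K + 1), R l ω ^ 2 / ((2 : ℝ) ^ l + 2 ^ k) ^ 2 :=
      Finset.single_le_sum (f := fun l => R l ω ^ 2 / ((2 : ℝ) ^ l + 2 ^ k) ^ 2)
        (fun l _ => by positivity) hl
    have h4 : (|S ω| / 2 ^ k) ^ 2 = S ω ^ 2 / (2 ^ k) ^ 2 := by rw [div_pow, sq_abs]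
    have h5 : (|R l ω| / (2 ^ l + 2 ^ k)) ^ 2 = R l ω ^ 2 / ((2 : ℝ) ^ l + 2 ^ k) ^ 2 := by
      rw [div_pow, sq_abs]
    rw [← h4]
    rw [← h5] at h3
    set a := |S ω| / 2 ^ k
    set b := |R l ω| / (2 ^ l + 2 ^ k)
    nlinarith [sq_nonneg (D - a), sq_nonneg (D - b), sq_nonneg (a - b)]
  have h0 := integral_mono (μ := μ) Integrable.of_finite Integrable.of_finite hpt
  rw [integral_const_mul, integral_add Integrable.of_finite Integrable.of_finite,
    integral_add Integrable.of_finite Integrable.of_finite,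
    integral_finsetSum _ fun _ _ => Integrable.of_finite, integral_div] at h0
  simp only [integral_div, integral_const, probReal_univ, smul_eq_mul, one_mul] at h0
  have h1 : (∫ ω, S ω ^ 2 ∂μ) / (2 ^ k) ^ 2 ≤ V * (2 / 2 ^ k) := by
    rw [div_le_iff₀ (by positivity)]
    refine hS.trans ?_
    have : (1 : ℝ) ≤ 2 ^ k := one_le_pow₀ one_le_two
    have e : V * (2 / 2 ^ k) * (2 ^ k) ^ 2 = V * (2 * 2 ^ k) := by field_simp
    rw [e]
    gcongr
    linarith
  have h2 : ∑ l ∈ Finset.range (K + 1), (∫ ω, R l ω ^ 2 ∂μ) / ((2 : ℝ) ^ l + 2 ^ k) ^ 2 ≤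
      V * (2 / 2 ^ k) := by
    refine le_trans ?_ (mul_le_mul_of_nonneg_left (sum_two_pow_div_sq_le (w := 2 ^ k)
      (by positivity) (K + 1)) hV)
    rw [Finset.mul_sum]
    refine Finset.sum_le_sum fun l _ => ?_
    rw [← mul_div_assoc]
    gcongr
    exact hR l
  have h3 : V * (2 / 2 ^ k) = 2 * V * (1 / 2 ^ k) := by ring
  have h4 : (0 : ℝ) < 1 / 2 ^ k := by positivity
  nlinarith [mul_nonneg hV (sq_nonneg D)]

end Risk

/-- Balancing drift against noise: a quantity bounded at every dyadic scale by the squared drift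
`D k ^ 2` plus the noise level `2 ^ (-k)` is bounded by a sum that is linear in the drifts.
Here `t ^ 2 = 1 / 2`. -/
lemma le_sum_of_le_drift {t A R : ℝ} (ht : 0 ≤ t) (ht2 : t ^ 2 = 1 / 2) (hA : 0 ≤ A) {D : ℕ → ℝ}
    (hD : ∀ k, 0 ≤ D k) (hD0 : D 0 ≤ 1) (K : ℕ)
    (h : ∀ k ≤ K, R ≤ A * (D k ^ 2 + (t ^ k) ^ 2)) :
    R ≤ 2 * A * ((t ^ K) ^ 2 + ∑ k ∈ Finset.range (K + 1), t ^ k * D k) := by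
  induction K with
  | zero =>
    have h0 := h 0 le_rfl
    have : D 0 ^ 2 ≤ 1 := pow_le_one₀ (hD 0) hD0
    simp only [pow_zero, zero_add, Finset.sum_range_one, one_pow, one_mul] at h0 ⊢
    nlinarith [mul_nonneg hA (hD 0)]
  | succ K ih =>
    have hsum : 0 ≤ ∑ k ∈ Finset.range (K + 1), t ^ k * D k :=
      Finset.sum_nonneg fun k _ => mul_nonneg (pow_nonneg ht k) (hD k)
    have hT : 0 ≤ t ^ (K + 1) := pow_nonneg ht _
    have hTD : 0 ≤ t ^ (K + 1) * D (K + 1) := mul_nonneg hT (hD _)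
    rw [Finset.sum_range_succ _ (K + 1)]
    rcases le_total (D (K + 1)) (t ^ (K + 1)) with hle | hle
    · refine (h (K + 1) le_rfl).trans ?_
      have : D (K + 1) ^ 2 ≤ (t ^ (K + 1)) ^ 2 := pow_le_pow_left₀ (hD _) hle 2
      rw [mul_comm 2 A, mul_assoc]
      refine mul_le_mul_of_nonneg_left ?_ hA
      linarith
    · refine (ih fun k hk => h k (by omega)).trans ?_
      have e : (t ^ K) ^ 2 = 2 * (t ^ (K + 1)) ^ 2 := by rw [pow_succ t K, mul_pow, ht2]; ring
      have : (t ^ (K + 1)) ^ 2 ≤ t ^ (K + 1) * D (K + 1) := by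
        rw [sq]; exact mul_le_mul_of_nonneg_left hle hT
      refine mul_le_mul_of_nonneg_left ?_ (by positivity)
      linarith

lemma sum_increment_le {p : ℤ → ℝ} (hp : ∀ j, p j ∈ Set.Icc (0 : ℝ) 1) (n w : ℕ) :
    ∑ i ∈ Finset.range n, (p ((i : ℤ) + w) - p i) ≤ w := by
  induction w with
  | zero => simp
  | succ w ih =>
    have h : ∑ i ∈ Finset.range n, (p ((i : ℤ) + (w + 1 : ℕ)) - p i) =
        ∑ i ∈ Finset.range n, (p (((i + 1 : ℕ) : ℤ) + w) - p ((i : ℤ) + w)) +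
          ∑ i ∈ Finset.range n, (p ((i : ℤ) + w) - p i) := by
      rw [← Finset.sum_add_distrib]
      refine Finset.sum_congr rfl fun i _ => ?_
      push_cast
      ring_nf
    rw [h, Finset.sum_range_sub fun i : ℕ => p ((i : ℤ) + w)]
    have h1 := (hp (((n : ℕ) : ℤ) + w)).2
    have h2 := (hp (((0 : ℕ) : ℤ) + w)).1
    push_cast at h2 ⊢
    linarith

lemma sum_sqrt_two_pow_le {s : ℝ} (hs : 4 / 3 ≤ s) (K : ℕ) :
    ∑ k ∈ Finset.range (K + 1), s ^ k ≤ 4 * s ^ K := by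
  induction K with
  | zero => simp
  | succ K ih =>
    rw [Finset.sum_range_succ]
    have : 0 ≤ s ^ K := by positivity
    rw [pow_succ]
    nlinarith

/-- The risk of the max-min estimator of a monotone sequence with values in `[0, 1]`, for noise
whose partial sums have linearly growing variance. -/
lemma sum_risk_dyadicMaxMin_le {Ω : Type*} [Finite Ω] [MeasurableSpace Ω]
    [MeasurableSingletonClass Ω] {μ : Measure Ω} [IsProbabilityMeasure μ] {p : ℤ → ℝ}
    (hp : Monotone p) (hp01 : ∀ j, p j ∈ Set.Icc (0 : ℝ) 1) {ξ : Ω → ℤ → ℝ} {V : ℝ} (hV : 0 ≤ V)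
    (hξ : ∀ J : Finset ℤ, ∫ ω, (∑ j ∈ J, ξ ω j) ^ 2 ∂μ ≤ V * J.card) {n : ℕ} {r : ℝ} (hr : 1 ≤ r)
    (hn : r ^ 3 = n) {K : ℕ} (hK : (2 : ℝ) ^ K ≤ r ^ 2) (hK' : r ^ 2 ≤ 2 ^ (K + 1)) :
    ∑ i ∈ Finset.range n, ∫ ω, (dyadicMaxMin K (fun j => p j + ξ ω j) i - p i) ^ 2 ∂μ ≤
      24 * (12 * V + 3) * r := by
  set A := 12 * V + 3 with hA
  have hA0 : 0 ≤ A := by positivity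
  set s := Real.sqrt 2 with hs
  have hs2 : s ^ 2 = 2 := Real.sq_sqrt (by norm_num)
  have hs0 : 0 < s := Real.sqrt_pos.2 (by norm_num)
  have hs1 : 4 / 3 ≤ s := Real.le_sqrt_of_sq_le (by norm_num)
  set t := s⁻¹ with ht
  have ht0 : 0 ≤ t := by positivity
  have ht2 : t ^ 2 = 1 / 2 := by rw [ht, inv_pow, hs2, one_div]
  have htk (k : ℕ) : (t ^ k) ^ 2 = 1 / 2 ^ k := by
    rw [← pow_mul, mul_comm, pow_mul, ht2, one_div_pow]
  have hcard (i : ℤ) (k : ℕ) : (Finset.Icc i (i + 2 ^ k)).card = 2 ^ k + 1 := by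
    rw [Int.card_Icc, show i + 2 ^ k + 1 - i = ((2 ^ k + 1 : ℕ) : ℤ) by push_cast; ring]
    rfl
  have hcard2 (i : ℤ) (k : ℕ) : (Finset.Icc (i - 2 ^ k) i).card = 2 ^ k + 1 := by
    rw [Int.card_Icc, show i + 1 - (i - 2 ^ k) = ((2 ^ k + 1 : ℕ) : ℤ) by push_cast; ring]
    rfl
  have hcard3 (i : ℤ) (k : ℕ) : (Finset.Ico (i - 2 ^ k) i).card = 2 ^ k := by
    rw [Int.card_Ico, show i - (i - 2 ^ k) = ((2 ^ k : ℕ) : ℤ) by push_cast; ring]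
    rfl
  have hcard4 (i : ℤ) (k : ℕ) : (Finset.Ioc i (i + 2 ^ k)).card = 2 ^ k := by
    rw [Int.card_Ioc, show i + 2 ^ k - i = ((2 ^ k : ℕ) : ℤ) by push_cast; ring]
    rfl
  have hup (i : ℤ) : ∫ ω, max (dyadicMaxMin K (fun j => p j + ξ ω j) i - p i) 0 ^ 2 ∂μ ≤
      2 * A * ((t ^ K) ^ 2 +
        ∑ k ∈ Finset.range (K + 1), t ^ k * (p (i + 2 ^ k) - p i)) := by
    refine le_sum_of_le_drift ht0 ht2 hA0 (fun k => sub_nonneg.2 (hp (by simp))) ?_ K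
      fun k hk => ?_
    · linarith [(hp01 (i + 2 ^ 0)).2, (hp01 i).1]
    · rw [htk]
      refine integral_sq_posPart_le (R := fun l ω => ∑ j ∈ Finset.Ico (i - 2 ^ l) i, ξ ω j) hV
        (sub_nonneg.2 (hp (by simp))) ?_ (fun l => ?_) fun ω => dyadicMaxMin_sub_le hk hp i
      · simpa [hcard] using hξ (Finset.Icc i (i + 2 ^ k))
      · simpa [hcard3] using hξ (Finset.Ico (i - 2 ^ l) i)
  have hdown (i : ℤ) : ∫ ω, max (p i - dyadicMaxMin K (fun j => p j + ξ ω j) i) 0 ^ 2 ∂μ ≤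
      2 * A * ((t ^ K) ^ 2 +
        ∑ k ∈ Finset.range (K + 1), t ^ k * (p i - p (i - 2 ^ k))) := by
    refine le_sum_of_le_drift ht0 ht2 hA0 (fun k => sub_nonneg.2 (hp (by simp))) ?_ K
      fun k hk => ?_
    · linarith [(hp01 i).2, (hp01 (i - 2 ^ 0)).1]
    · rw [htk]
      refine integral_sq_posPart_le (R := fun l ω => ∑ j ∈ Finset.Ioc i (i + 2 ^ l), ξ ω j) hV
        (sub_nonneg.2 (hp (by simp))) ?_ (fun l => ?_) fun ω => sub_dyadicMaxMin_le hk hp i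
      · simpa [hcard2] using hξ (Finset.Icc (i - 2 ^ k) i)
      · simpa [hcard4] using hξ (Finset.Ioc i (i + 2 ^ l))
  have hpart (x : ℝ) : x ^ 2 = max x 0 ^ 2 + max (-x) 0 ^ 2 := by
    rcases le_total 0 x with h | h
    · rw [max_eq_left h, max_eq_right (by linarith)]; ring
    · rw [max_eq_right h, max_eq_left (by linarith)]; ring
  have htwo (i : ℤ) : ∫ ω, (dyadicMaxMin K (fun j => p j + ξ ω j) i - p i) ^ 2 ∂μ ≤
      2 * A * (2 * (t ^ K) ^ 2 + ∑ k ∈ Finset.range (K + 1),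
        t ^ k * ((p (i + 2 ^ k) - p i) + (p i - p (i - 2 ^ k)))) := by
    simp_rw [hpart (dyadicMaxMin K _ i - p i), neg_sub]
    rw [integral_add Integrable.of_finite Integrable.of_finite]
    refine (add_le_add (hup i) (hdown i)).trans (le_of_eq ?_)
    simp only [mul_add (t ^ _), Finset.sum_add_distrib]
    ring
  refine (Finset.sum_le_sum fun (i : ℕ) _ => htwo (i : ℤ)).trans ?_
  rw [← Finset.mul_sum, Finset.sum_add_distrib, Finset.sum_comm]
  have hdrift (k : ℕ) : ∑ i ∈ Finset.range n,
      t ^ k * ((p ((i : ℤ) + 2 ^ k) - p i) + (p i - p ((i : ℤ) - 2 ^ k))) ≤ 2 * s ^ k := by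
    rw [← Finset.mul_sum, Finset.sum_add_distrib]
    have h1 := sum_increment_le hp01 n (2 ^ k)
    have h2 := sum_increment_le (p := fun j => p (j - 2 ^ k)) (fun j => hp01 _) n (2 ^ k)
    push_cast at h1 h2
    simp only [add_sub_cancel_right] at h2
    have e : t ^ k * 2 ^ k = s ^ k := by
      rw [← mul_pow, ht]
      congr 1
      field_simp
      exact hs2.symm
    calc _ ≤ t ^ k * (2 ^ k + 2 ^ k) := by gcongr
      _ = _ := by rw [← two_mul, ← e]; ring
  have hgeo : ∑ k ∈ Finset.range (K + 1), 2 * s ^ k ≤ 8 * r := by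
    rw [← Finset.mul_sum]
    have h1 := sum_sqrt_two_pow_le hs1 K
    have h2 : s ^ K ≤ r := by
      refine (sq_le_sq₀ (by positivity) (by linarith)).1 ?_
      rwa [← pow_mul, mul_comm, pow_mul, hs2]
    linarith
  have hbias : (n : ℝ) * (2 * (t ^ K) ^ 2) ≤ 4 * r := by
    have hr0 : 0 < r := by linarith
    rw [htk, ← hn, show r ^ 3 * (2 * (1 / 2 ^ K)) = (2 * r ^ 3) / 2 ^ K by ring,
      div_le_iff₀ (by positivity)]
    have := mul_le_mul_of_nonneg_left hK' hr0.le
    rw [pow_succ (2 : ℝ) K] at this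
    nlinarith
  have hdsum := Finset.sum_le_sum fun k (_ : k ∈ Finset.range (K + 1)) => hdrift k
  rw [Finset.sum_const, Finset.card_range, nsmul_eq_mul]
  calc _ ≤ 2 * A * (4 * r + 8 * r) := by
        refine mul_le_mul_of_nonneg_left ?_ (by positivity)
        linarith
    _ = _ := by ring

end DyadicMinMax

/-! ### Upper bound in dimension one -/

section UnivariateUpperBound

variable {m : ℕ}

/-- Extension of a vector indexed by `{0, …, m - 1}` to the integers, by `0` on the left and by `1`
on the right; it keeps monotone vectors with values in `[0, 1]` monotone and spares the discussion
of windows that stick out. -/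
noncomputable def pad (x : (Fin 1 → Fin m) → ℝ) (j : ℤ) : ℝ :=
  if j < 0 then 0 else if h : j.toNat < m then x fun _ => ⟨j.toNat, h⟩ else 1

lemma pad_natCast (x : (Fin 1 → Fin m) → ℝ) (k : Fin 1 → Fin m) : pad x ((k 0 : ℕ) : ℤ) = x k := by
  have : (fun _ => k 0 : Fin 1 → Fin m) = k := funext fun j => by rw [Subsingleton.elim j 0]
  simp [pad, this]

lemma pad_mem_Icc {x : (Fin 1 → Fin m) → ℝ} (hx : ∀ k, x k ∈ Set.Icc (0 : ℝ) 1) (j : ℤ) :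
    pad x j ∈ Set.Icc (0 : ℝ) 1 := by
  unfold pad
  split_ifs
  · simp
  · exact hx _
  · simp

lemma pad_monotone {x : (Fin 1 → Fin m) → ℝ} (hx : ∀ k, x k ∈ Set.Icc (0 : ℝ) 1)
    (hmono : Monotone x) : Monotone (pad x) := by
  intro i j hij
  by_cases hi : i < 0
  · simpa [pad, hi] using (pad_mem_Icc hx j).1
  have hj : ¬ j < 0 := by omega
  by_cases hjm : j.toNat < m
  · have him : i.toNat < m := by omega
    simp only [pad, hi, hj, if_false, him, hjm, dif_pos]
    exact hmono fun _ => Fin.mk_le_mk.2 (by omega)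
  · simpa [pad, hj, hjm] using (pad_mem_Icc hx i).2

lemma pad_sub_pad (x z : (Fin 1 → Fin m) → ℝ) (j : ℤ) :
    pad x j - pad z j = ∑ k, if ((k 0 : ℕ) : ℤ) = j then x k - z k else 0 := by
  by_cases h : 0 ≤ j ∧ j.toNat < m
  · have hj : ¬ j < 0 := by omega
    rw [Finset.sum_eq_single (fun _ => (⟨j.toNat, h.2⟩ : Fin m))]
    · simp [pad, hj, h.2, h.1]
    · intro k _ hk
      refine if_neg fun hkj => hk (funext fun i => Fin.ext ?_)
      rw [Subsingleton.elim i 0]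
      simp only
      omega
    · simp
  · rw [Finset.sum_eq_zero fun k _ => if_neg fun hkj => h ?_]
    · by_cases hj : j < 0
      · simp [pad, hj]
      · have : ¬ j.toNat < m := fun h' => h ⟨by omega, h'⟩
        simp [pad, hj, this]
    · have := (k 0).2
      omega

lemma integral_sq_sum_pad_noise_le (θ : EuclideanSpace ℝ (Fin 1 → Fin m)) (J : Finset ℤ) :
    ∫ y, (∑ j ∈ J, (pad (fun k => outcome (y k)) j - pad (fun k => Real.sigmoid (θ k)) j)) ^ 2
      ∂(dataLaw θ) ≤ 8 * J.card := by
  have h (y : (Fin 1 → Fin m) → Bool) :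
      ∑ j ∈ J, (pad (fun k => outcome (y k)) j - pad (fun k => Real.sigmoid (θ k)) j) =
        ∑ k, (if ((k 0 : ℕ) : ℤ) ∈ J then 1 else 0) * noise θ y k := by
    simp_rw [pad_sub_pad]
    rw [Finset.sum_comm]
    refine Finset.sum_congr rfl fun k _ => ?_
    rw [Finset.sum_ite_eq J]
    simp [noise]
  simp_rw [h]
  refine (integral_sq_sum_noise_le θ _).trans ?_
  have : ∑ k : Fin 1 → Fin m, (if ((k 0 : ℕ) : ℤ) ∈ J then (1 : ℝ) else 0) ^ 2 =
      (Finset.univ.filter fun k : Fin 1 → Fin m => ((k 0 : ℕ) : ℤ) ∈ J).card := by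
    simp [ite_pow]
  rw [this]
  have hc := Finset.card_le_card_of_injOn
    (s := Finset.univ.filter fun k : Fin 1 → Fin m => ((k 0 : ℕ) : ℤ) ∈ J) (t := J)
    (fun k => ((k 0 : ℕ) : ℤ)) (fun k hk => (Finset.mem_filter.1 hk).2) fun k _ l _ hkl => by
      funext j
      rw [Subsingleton.elim j 0]
      exact Fin.ext (by simpa using hkl)
  gcongr

lemma minimaxRisk_evaluations_one_le {M : ℝ} (hM : 0 < M) (hm : 1 ≤ m) :
    minimaxRisk (evaluations 1 m (-M) M) ≤
      ENNReal.ofReal (4 / Real.sigmoid (-M) ^ 4 * (2376 * (m : ℝ) ^ (1 / 3 : ℝ))) := by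
  set r := (m : ℝ) ^ (1 / 3 : ℝ) with hr
  have hm1 : (1 : ℝ) ≤ m := by exact_mod_cast hm
  have hr1 : 1 ≤ r := Real.one_le_rpow hm1 (by norm_num)
  have hr3 : r ^ 3 = m := by
    rw [hr, ← Real.rpow_natCast, ← Real.rpow_mul (by positivity)]; norm_num
  obtain ⟨K, hK, hK'⟩ := exists_nat_pow_near (one_le_pow₀ hr1 : 1 ≤ r ^ 2) (one_lt_two (α := ℝ))
  refine minimaxRisk_le_of_estimator hM (fun θ hθ => mem_Icc_of_mem_evaluations hθ)
    (fun y k => dyadicMaxMin K (pad fun k => outcome (y k)) ((k 0 : ℕ) : ℤ)) fun θ hθ => ?_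
  set p := pad fun k => Real.sigmoid (θ k) with hp
  have h01 (k : Fin 1 → Fin m) : Real.sigmoid (θ k) ∈ Set.Icc (0 : ℝ) 1 :=
    ⟨Real.sigmoid_nonneg _, Real.sigmoid_le_one _⟩
  have hmain := sum_risk_dyadicMaxMin_le (μ := dataLaw θ)
    (pad_monotone h01 (Real.sigmoid_monotone.comp (monotone_of_mem_evaluations hθ)))
    (pad_mem_Icc h01)
    (ξ := fun y j => pad (fun k => outcome (y k)) j - p j) (V := 8) (by norm_num)
    (integral_sq_sum_pad_noise_le θ) hr1 hr3 hK hK'.le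
  rw [integral_finsetSum _ fun _ _ => Integrable.of_finite]
  refine le_trans (le_of_eq ?_) (hmain.trans (by linarith))
  rw [← Fin.sum_univ_eq_sum_range (fun i => ∫ y, (dyadicMaxMin K (fun j => _ + _) (i : ℤ) - _) ^ 2
    ∂(dataLaw θ)), ← (Equiv.funUnique (Fin 1) (Fin m)).sum_comp]
  refine Finset.sum_congr rfl fun k _ => ?_
  simp only [Equiv.funUnique_apply, Fin.default_eq_zero, hp, add_sub_cancel, pad_natCast]

end UnivariateUpperBound

/-! ### Counting upper sets of the lattice -/

section UpperSets

/-- The number of points of an upper set on a line parallel to the second axis. -/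
noncomputable def sliceCard {d a : ℕ} (V : Finset (Fin (d + 2) → Fin a)) (z : Fin d → Fin a)
    (i : Fin a) : ℕ :=
  (Finset.univ.filter fun k : Fin a => (Fin.cons i (Fin.cons k z) : Fin (d + 2) → Fin a) ∈ V).card

lemma cons_cons_le {d a : ℕ} {i i' k k' : Fin a} {z : Fin d → Fin a} (hi : i ≤ i') (hk : k ≤ k') :
    (Fin.cons i (Fin.cons k z) : Fin (d + 2) → Fin a) ≤ Fin.cons i' (Fin.cons k' z) := by
  intro j
  refine Fin.cases ?_ (fun j => Fin.cases ?_ (fun j => ?_) j) j <;> simp [hi, hk]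

lemma sliceCard_le {d a : ℕ} (V : Finset (Fin (d + 2) → Fin a)) (z : Fin d → Fin a)
    (i : Fin a) : sliceCard V z i ≤ a := by
  simpa [sliceCard] using Finset.card_le_univ
    (Finset.univ.filter fun k : Fin a => (Fin.cons i (Fin.cons k z) : Fin (d + 2) → Fin a) ∈ V)

lemma sliceCard_mono {d a : ℕ} {V : Finset (Fin (d + 2) → Fin a)}
    (hV : IsUpperSet (V : Set (Fin (d + 2) → Fin a))) (z : Fin d → Fin a) :
    Monotone (sliceCard V z) := by
  intro i j hij
  refine Finset.card_le_card fun k hk => ?_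
  rw [Finset.mem_filter] at hk ⊢
  exact ⟨hk.1, hV (cons_cons_le hij le_rfl) hk.2⟩

/-- The lattice path bounding a two-dimensional slice of an upper set, recorded by its `a`
horizontal steps among `2 a` steps. -/
noncomputable def slicePath {d a : ℕ} (V : Finset (Fin (d + 2) → Fin a)) (z : Fin d → Fin a)
    (i : Fin a) : Fin (2 * a) :=
  ⟨i + sliceCard V z i, by have := sliceCard_le V z i; omega⟩

lemma slicePath_strictMono {d a : ℕ} {V : Finset (Fin (d + 2) → Fin a)}
    (hV : IsUpperSet (V : Set (Fin (d + 2) → Fin a))) (z : Fin d → Fin a) :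
    StrictMono (slicePath V z) := by
  intro i j hij
  have h := sliceCard_mono hV z hij.le
  simp only [slicePath, Fin.mk_lt_mk]
  have : (i : ℕ) < j := hij
  omega

lemma eq_of_slicePath_eq {d a : ℕ} {V W : Finset (Fin (d + 2) → Fin a)}
    (hV : IsUpperSet (V : Set (Fin (d + 2) → Fin a)))
    (hW : IsUpperSet (W : Set (Fin (d + 2) → Fin a)))
    (h : ∀ z i, slicePath V z i = slicePath W z i) : V = W := by
  have hslice (z : Fin d → Fin a) (i : Fin a) :
      (Finset.univ.filter fun k : Fin a =>
        (Fin.cons i (Fin.cons k z) : Fin (d + 2) → Fin a) ∈ V) =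
      Finset.univ.filter fun k : Fin a =>
        (Fin.cons i (Fin.cons k z) : Fin (d + 2) → Fin a) ∈ W := by
    have hc : sliceCard V z i = sliceCard W z i := by
      have := congrArg Fin.val (h z i)
      simp only [slicePath] at this
      omega
    have hV' : IsUpperSet {k : Fin a | (Fin.cons i (Fin.cons k z) : Fin (d + 2) → Fin a) ∈ V} :=
      fun k k' hk hkV => hV (cons_cons_le le_rfl hk) hkV
    have hW' : IsUpperSet {k : Fin a | (Fin.cons i (Fin.cons k z) : Fin (d + 2) → Fin a) ∈ W} :=
      fun k k' hk hkW => hW (cons_cons_le le_rfl hk) hkW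
    -- upper sets of a chain are nested, so their cardinality determines them
    rcases hV'.total hW' with hsub | hsub
    · refine Finset.eq_of_subset_of_card_le (fun k hk => ?_) hc.ge
      simpa using hsub (by simpa using hk)
    · refine (Finset.eq_of_subset_of_card_le (fun k hk => ?_) hc.le).symm
      simpa using hsub (by simpa using hk)
  ext x
  have hx : (Fin.cons (x 0) (Fin.cons (x 1) (Fin.tail (Fin.tail x))) : Fin (d + 2) → Fin a) =
      x := by
    have : (Fin.cons (x 1) (Fin.tail (Fin.tail x)) : Fin (d + 1) → Fin a) = Fin.tail x :=
      Fin.cons_self_tail (Fin.tail x)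
    rw [this, Fin.cons_self_tail]
  have := Finset.ext_iff.1 (hslice (Fin.tail (Fin.tail x)) (x 0)) (x 1)
  simpa [hx] using this

open Classical in
/-- The upper sets of the lattice `{0, …, a - 1}^q`. -/
noncomputable def upperFinsets (q a : ℕ) : Finset (Finset (Fin q → Fin a)) :=
  Finset.univ.filter fun V => IsUpperSet (V : Set (Fin q → Fin a))

lemma mem_upperFinsets {q a : ℕ} {V : Finset (Fin q → Fin a)} :
    V ∈ upperFinsets q a ↔ IsUpperSet (V : Set (Fin q → Fin a)) := by
  simp [upperFinsets]

lemma upperFinsets_nonempty (q a : ℕ) : (upperFinsets q a).Nonempty :=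
  ⟨∅, mem_upperFinsets.2 (by simpa using isUpperSet_empty)⟩

/-- An upper set is determined by the lattice paths bounding its two-dimensional slices, which
gives a count without logarithmic factor in the exponent. -/
lemma card_upperFinsets_le (d a : ℕ) : (upperFinsets (d + 2) a).card ≤ 4 ^ a ^ (d + 1) := by
  classical
  have h := Finset.card_le_card_of_injOn (s := upperFinsets (d + 2) a)
    (t := (Finset.univ : Finset ((Fin d → Fin a) → Finset (Fin (2 * a)))))
    (fun V z => Finset.univ.image (slicePath V z)) (fun _ _ => Finset.mem_univ _) (by
      intro V hV W hW hVW
      have hV' := mem_upperFinsets.1 hV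
      have hW' := mem_upperFinsets.1 hW
      refine eq_of_slicePath_eq hV' hW' fun z => congrFun ?_
      refine ((slicePath_strictMono hV' z).range_inj (slicePath_strictMono hW' z)).1 ?_
      have := congrFun hVW z
      simpa using congrArg (fun s : Finset (Fin (2 * a)) => (s : Set (Fin (2 * a)))) this)
  refine h.trans (le_of_eq ?_)
  simp only [Finset.card_univ, Fintype.card_fun, Fintype.card_finset, Fintype.card_fin]
  rw [← pow_mul, pow_succ a d, mul_comm (a ^ d), mul_assoc, pow_mul]
  norm_num

end UpperSets

/-! ### Sets meeting every diagonal in a short stretch -/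

section Diagonals

variable {q m : ℕ}

lemma card_exists_zero_le [NeZero m] (r : ℕ) :
    (Finset.univ.filter fun z : Fin (r + 1) → Fin m => ∃ i, z i = 0).card ≤ (r + 1) * m ^ r := by
  classical
  have hsub : (Finset.univ.filter fun z : Fin (r + 1) → Fin m => ∃ i, z i = 0) ⊆
      Finset.univ.biUnion fun i => Finset.univ.filter fun z : Fin (r + 1) → Fin m => z i = 0 := by
    intro z hz
    simpa using hz
  refine (Finset.card_le_card hsub).trans ((Finset.card_biUnion_le_card_mul _ _ (m ^ r) ?_).trans
    (by simp))
  intro i _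
  refine (Finset.card_le_card_of_injOn (t := (Finset.univ : Finset (Fin r → Fin m)))
    (fun z k => z (i.succAbove k)) (fun _ _ => Finset.mem_univ _) ?_).trans (by simp)
  intro z hz w hw hzw
  simp only [Finset.coe_filter, Finset.mem_univ, true_and, Set.mem_ofPred_eq] at hz hw
  funext j
  rcases eq_or_ne j i with rfl | hj
  · rw [hz, hw]
  · obtain ⟨k, rfl⟩ := Fin.exists_succAbove_eq hj
    exact congrFun hzw k

/-- A set of lattice points that meets every diagonal in a stretch of length less than `s` has at
most `s` points on each of the `O(m ^ (q - 1))` diagonals. -/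
lemma card_le_of_diagonal {r s : ℕ} [NeZero m] (D : Finset (Fin (r + 1) → Fin m))
    (hD : ∀ x ∈ D, ∀ y ∈ D, ∀ t : ℕ, (∀ i, (y i : ℕ) = x i + t) → t < s) :
    D.card ≤ (r + 1) * m ^ r * s := by
  classical
  let mn : (Fin (r + 1) → Fin m) → ℕ := fun x =>
    Finset.univ.inf' Finset.univ_nonempty fun i => (x i : ℕ)
  have hmn (x : Fin (r + 1) → Fin m) (i) : mn x ≤ x i := Finset.inf'_le _ (Finset.mem_univ i)
  let base : (Fin (r + 1) → Fin m) → (Fin (r + 1) → Fin m) := fun x i =>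
    ⟨x i - mn x, (Nat.sub_le _ _).trans_lt (x i).2⟩
  have hs (x) (hx : x ∈ D) : 0 < s := hD x hx x hx 0 fun i => rfl
  have h := Finset.card_le_card_of_injOn (s := D)
    (t := (Finset.univ.filter fun z : Fin (r + 1) → Fin m => ∃ i, z i = 0) ×ˢ Finset.range s)
    (fun x => (base x, mn x % s)) (fun x hx => by
      obtain ⟨i, -, hi⟩ := Finset.exists_mem_eq_inf' (s := (Finset.univ : Finset (Fin (r + 1))))
        Finset.univ_nonempty fun i => (x i : ℕ)
      have : base x i = 0 := Fin.ext (by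
        simp only [base, mn, hi, Nat.sub_self, Fin.val_zero])
      simpa using ⟨⟨i, this⟩, Nat.mod_lt _ (hs x hx)⟩) (by
      have key : ∀ x ∈ D, ∀ y ∈ D, base x = base y → mn x % s = mn y % s → mn x ≤ mn y → x = y := by
        intro x hx y hy hb hmod hle
        have hb' (i) : (x i : ℕ) - mn x = y i - mn y := congrArg Fin.val (congrFun hb i)
        have ht := hD x hx y hy (mn y - mn x) fun i => by
          have := hb' i; have := hmn x i; have := hmn y i; omega
        have h0 : mn y - mn x = 0 :=
          Nat.eq_zero_of_dvd_of_lt ((Nat.modEq_iff_dvd' hle).1 hmod) ht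
        funext i
        refine Fin.ext ?_
        have := hb' i; have := hmn x i; have := hmn y i; omega
      intro x hx y hy hxy
      obtain ⟨hb, hmod⟩ := Prod.ext_iff.1 hxy
      rcases le_total (mn x) (mn y) with hle | hle
      · exact key x hx y hy hb hmod hle
      · exact (key y hy x hx hb.symm hmod.symm hle).symm)
  rw [Finset.card_product, Finset.card_range] at h
  exact h.trans (Nat.mul_le_mul_right _ (card_exists_zero_le r))

end Diagonals

/-! ### Dyadic approximation of upper sets -/

section DyadicApproximation

variable {q m : ℕ}

/-- The dyadic cube of side `2 ^ j` containing a lattice point. -/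
def cubeOf (j : ℕ) (x : Fin q → Fin m) : Fin q → Fin (m / 2 ^ j + 1) :=
  fun i => ⟨x i / 2 ^ j, Nat.lt_succ_of_le (Nat.div_le_div_right (x i).2.le)⟩

/-- Rounding down to even coordinates: the lower corner of the next coarser dyadic cube. -/
def evenFloor {a : ℕ} (z : Fin q → Fin a) : Fin q → Fin a :=
  fun i => ⟨2 * (z i / 2), (Nat.mul_div_le _ _).trans_lt (z i).2⟩

/-- The lower corner of the dyadic cube of side `2 ^ j` containing a lattice point. -/
def dyadicFloor (j : ℕ) (x : Fin q → Fin m) : Fin q → Fin m :=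
  fun i => ⟨2 ^ j * (x i / 2 ^ j), (Nat.mul_div_le _ _).trans_lt (x i).2⟩

/-- The lattice points whose cube of side `2 ^ j` belongs to `V` while the lower corner of their
cube of side `2 ^ (j + 1)` does not. -/
def dyadicShell (j : ℕ) (V : Finset (Fin q → Fin (m / 2 ^ j + 1))) : Finset (Fin q → Fin m) :=
  Finset.univ.filter fun x => cubeOf j x ∈ V ∧ evenFloor (cubeOf j x) ∉ V

lemma card_dyadicShell_le {r : ℕ} [NeZero m] (j : ℕ)
    {V : Finset (Fin (r + 1) → Fin (m / 2 ^ j + 1))}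
    (hV : IsUpperSet (V : Set (Fin (r + 1) → Fin (m / 2 ^ j + 1)))) :
    (dyadicShell (m := m) j V).card ≤ (r + 1) * m ^ r * 2 ^ (j + 1) := by
  refine card_le_of_diagonal _ fun x hx y hy t ht => ?_
  by_contra! hle
  obtain ⟨-, hxV, -⟩ := Finset.mem_filter.1 hx
  obtain ⟨-, -, hyV⟩ := Finset.mem_filter.1 hy
  -- moving up the diagonal by `2 ^ (j + 1)` passes the corner of a coarser cube
  refine hyV (hV (fun i => Fin.mk_le_mk.2 ?_) hxV)
  have h1 : ((x i : ℕ) + 2 ^ j * 2) / 2 ^ j ≤ (y i : ℕ) / 2 ^ j := by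
    refine Nat.div_le_div_right ?_
    rw [ht i, ← pow_succ]
    omega
  rw [Nat.add_mul_div_left _ _ (by positivity)] at h1
  simp only [cubeOf]
  omega

lemma exists_upperFinset_dyadicShell_eq [NeZero m] [DecidableEq (Fin q → Fin m)] (j : ℕ)
    {U : Finset (Fin q → Fin m)} (hU : IsUpperSet (U : Set (Fin q → Fin m))) :
    ∃ V ∈ upperFinsets q (m / 2 ^ j + 1), dyadicShell j V =
      (Finset.univ.filter fun x => dyadicFloor j x ∈ U) \
        Finset.univ.filter fun x => dyadicFloor (j + 1) x ∈ U := by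
  have hm : 0 < m := Nat.pos_of_ne_zero (NeZero.ne m)
  -- the lower corner of a cube, clamped since the outermost cubes may start outside the lattice
  let corner : (Fin q → Fin (m / 2 ^ j + 1)) → (Fin q → Fin m) := fun z i =>
    ⟨min (2 ^ j * z i) (m - 1), by omega⟩
  have hcorner (x : Fin q → Fin m) : corner (cubeOf j x) = dyadicFloor j x := by
    funext i
    refine Fin.ext ?_
    have h1 := Nat.mul_div_le (x i : ℕ) (2 ^ j)
    have h2 := (x i).2
    simp only [corner, cubeOf, dyadicFloor]
    omega
  have hcorner2 (x : Fin q → Fin m) : corner (evenFloor (cubeOf j x)) = dyadicFloor (j + 1) x := by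
    funext i
    refine Fin.ext ?_
    have h1 := Nat.mul_div_le (x i : ℕ) (2 ^ (j + 1))
    have h2 := (x i).2
    have h3 : 2 ^ j * (2 * ((x i : ℕ) / 2 ^ j / 2)) = 2 ^ (j + 1) * ((x i : ℕ) / 2 ^ (j + 1)) := by
      rw [Nat.div_div_eq_div_mul, ← mul_assoc, ← pow_succ]
    simp only [corner, cubeOf, evenFloor, dyadicFloor, h3]
    omega
  refine ⟨Finset.univ.filter fun z => corner z ∈ U, mem_upperFinsets.2 ?_, ?_⟩
  · intro z w hzw hz
    simp only [Finset.coe_filter, Finset.mem_univ, true_and, Set.mem_ofPred_eq] at hz ⊢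
    refine hU (fun i => Fin.mk_le_mk.2 (min_le_min_right _ (Nat.mul_le_mul_left _ (hzw i)))) hz
  · ext x
    simp [dyadicShell, hcorner, hcorner2]

/-- Chaining: an upper set is the disjoint union of its dyadic shells and of its coarsest
approximation, which is everything or nothing. -/
lemma exists_sum_upperSet_le [NeZero m] {K : ℕ} (hK : m ≤ 2 ^ (K + 1)) {U : Finset (Fin q → Fin m)}
    (hU : IsUpperSet (U : Set (Fin q → Fin m))) (ξ : (Fin q → Fin m) → ℝ) :
    ∃ V : (j : ℕ) → Finset (Fin q → Fin (m / 2 ^ j + 1)), (∀ j, V j ∈ upperFinsets q _) ∧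
      ∑ x ∈ U, ξ x ≤ ∑ j ∈ Finset.range (K + 1), ∑ x ∈ dyadicShell j (V j), ξ x + |∑ x, ξ x| := by
  classical
  choose V hV hVeq using fun j => exists_upperFinset_dyadicShell_eq j hU
  refine ⟨V, hV, ?_⟩
  let S : ℕ → Finset (Fin q → Fin m) := fun j => Finset.univ.filter fun x => dyadicFloor j x ∈ U
  have hsub (j : ℕ) : S (j + 1) ⊆ S j := by
    intro x hx
    simp only [S, Finset.mem_filter, Finset.mem_univ, true_and] at hx ⊢
    refine hU (fun i => Fin.mk_le_mk.2 ?_) hx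
    have h3 : 2 ^ j * (2 * ((x i : ℕ) / 2 ^ j / 2)) = 2 ^ (j + 1) * ((x i : ℕ) / 2 ^ (j + 1)) := by
      rw [Nat.div_div_eq_div_mul, ← mul_assoc, ← pow_succ]
    rw [← h3]
    exact Nat.mul_le_mul_left _ (Nat.mul_div_le _ _)
  have hstep (j : ℕ) : ∑ x ∈ dyadicShell j (V j), ξ x = ∑ x ∈ S j, ξ x - ∑ x ∈ S (j + 1), ξ x := by
    rw [hVeq, ← Finset.sum_sdiff (hsub j)]
    ring
  simp_rw [hstep]
  rw [Finset.sum_range_sub' fun j => ∑ x ∈ S j, ξ x]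
  have h0 : S 0 = U := by
    ext x
    have : dyadicFloor 0 x = x := funext fun i => Fin.ext (by simp [dyadicFloor])
    simp [S, this]
  have htop : ∑ x ∈ S (K + 1), ξ x ≤ |∑ x, ξ x| := by
    have hconst (x y : Fin q → Fin m) : dyadicFloor (K + 1) x = dyadicFloor (K + 1) y := by
      funext i
      refine Fin.ext ?_
      simp only [dyadicFloor]
      rw [Nat.div_eq_of_lt ((x i).2.trans_le hK), Nat.div_eq_of_lt ((y i).2.trans_le hK)]
    rcases (S (K + 1)).eq_empty_or_nonempty with he | ⟨x, hx⟩
    · simp [he]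
    · have : S (K + 1) = Finset.univ := by
        ext y
        have hx' := (Finset.mem_filter.1 hx).2
        simp only [S, Finset.mem_filter, Finset.mem_univ, true_and, iff_true]
        rwa [hconst y x]
      rw [this]
      exact le_abs_self _
  rw [h0]
  linarith

end DyadicApproximation

/-! ### Least squares over monotone vectors -/

section LeastSquares

variable {q m : ℕ}

/-- The monotone functions on the lattice with values in `[0, 1]`. -/
def monotoneVectors (q m : ℕ) : Set ((Fin q → Fin m) → ℝ) :=
  Set.Icc 0 1 ∩ {g | Monotone g}

lemma setIntegral_indicator_Iic {g : ℝ} (hg : g ∈ Set.Icc (0 : ℝ) 1) :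
    ∫ t in Set.Ioc (0 : ℝ) 1, (Set.Iic g).indicator (fun _ => (1 : ℝ)) t = g := by
  rw [setIntegral_indicator measurableSet_Iic]
  have : Set.Ioc (0 : ℝ) 1 ∩ Set.Iic g = Set.Ioc 0 g := by
    ext t
    simp only [Set.mem_inter_iff, Set.mem_Ioc, Set.mem_Iic]
    constructor
    · rintro ⟨⟨h1, -⟩, h2⟩; exact ⟨h1, h2⟩
    · rintro ⟨h1, h2⟩; exact ⟨⟨h1, h2.trans hg.2⟩, h2⟩
  rw [this]
  simp [hg.1]

/-- Layer-cake: a linear form on monotone vectors is controlled by its values on the indicators of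
upper sets. -/
lemma sum_mul_le_of_forall_upperSet {ξ g : (Fin q → Fin m) → ℝ} (hg : g ∈ monotoneVectors q m)
    {B : ℝ} (hB : ∀ U ∈ upperFinsets q m, ∑ x ∈ U, ξ x ≤ B) : ∑ x, ξ x * g x ≤ B := by
  classical
  have h01 (x) : g x ∈ Set.Icc (0 : ℝ) 1 := ⟨hg.1.1 x, hg.1.2 x⟩
  have hint (x) : IntegrableOn (fun t => ξ x * (Set.Iic (g x)).indicator (fun _ => (1 : ℝ)) t)
      (Set.Ioc (0 : ℝ) 1) :=
    ((integrable_const (1 : ℝ)).indicator measurableSet_Iic).const_mul _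
  calc ∑ x, ξ x * g x
      = ∑ x, ∫ t in Set.Ioc (0 : ℝ) 1, ξ x * (Set.Iic (g x)).indicator (fun _ => (1 : ℝ)) t := by
        refine Finset.sum_congr rfl fun x _ => ?_
        rw [integral_const_mul, setIntegral_indicator_Iic (h01 x)]
    _ = ∫ t in Set.Ioc (0 : ℝ) 1, ∑ x, ξ x * (Set.Iic (g x)).indicator (fun _ => (1 : ℝ)) t :=
        (integral_finsetSum _ fun x _ => hint x).symm
    _ ≤ ∫ _t in Set.Ioc (0 : ℝ) 1, B := by
        refine setIntegral_mono (integrable_finsetSum _ fun x _ => hint x) (integrable_const _)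
          fun t => ?_
        have hU : (Finset.univ.filter fun x => t ≤ g x) ∈ upperFinsets q m := by
          refine mem_upperFinsets.2 fun x y hxy hx => ?_
          simp only [Finset.coe_filter, Finset.mem_univ, true_and, Set.mem_ofPred_eq] at hx ⊢
          exact hx.trans (hg.2 hxy)
        refine le_trans (le_of_eq ?_) (hB _ hU)
        rw [Finset.sum_filter]
        exact Finset.sum_congr rfl fun x _ => by simp [Set.indicator_apply]
    _ = B := by simp

lemma exists_leastSquares (Y : (Fin q → Fin m) → ℝ) :
    ∃ g ∈ monotoneVectors q m, ∀ p ∈ monotoneVectors q m,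
      ∑ x, (Y x - g x) ^ 2 ≤ ∑ x, (Y x - p x) ^ 2 := by
  have hc : IsCompact (monotoneVectors q m) :=
    isCompact_Icc.inter_right isClosed_monotone
  obtain ⟨g, hg, hmin⟩ := hc.exists_isMinOn ⟨0, ⟨le_rfl, zero_le_one⟩, monotone_const⟩
    (f := fun g => ∑ x, (Y x - g x) ^ 2) (by fun_prop)
  exact ⟨g, hg, fun p hp => hmin hp⟩

lemma sum_sq_leastSquares_le {Y g p : (Fin q → Fin m) → ℝ}
    (h : ∑ x, (Y x - g x) ^ 2 ≤ ∑ x, (Y x - p x) ^ 2) :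
    ∑ x, (g x - p x) ^ 2 ≤ 2 * (∑ x, (Y x - p x) * g x - ∑ x, p x * (Y x - p x)) := by
  have e : ∑ x, (Y x - g x) ^ 2 = ∑ x, (Y x - p x) ^ 2 + ∑ x, (g x - p x) ^ 2 -
      2 * (∑ x, (Y x - p x) * g x - ∑ x, p x * (Y x - p x)) := by
    rw [← Finset.sum_sub_distrib, Finset.mul_sum, ← Finset.sum_add_distrib,
      ← Finset.sum_sub_distrib]
    exact Finset.sum_congr rfl fun x _ => by ring
  linarith

end LeastSquares

/-! ### Chaining over dyadic scales -/

section Chaining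

variable {d m : ℕ}

/-- At each dyadic scale the entropy of the shells and their size balance to
`m ^ (q - 1) * 2 ^ (-j (q - 2) / 2)`, where `q = d + 2` and `t = 2 ^ (-1 / 2)`. -/
lemma integral_sup'_dyadicShell_le [NeZero m] (θ : EuclideanSpace ℝ (Fin (d + 2) → Fin m)) {t : ℝ}
    (ht : 0 < t) (ht2 : t ^ 2 = 1 / 2) {j : ℕ} (hj : 2 ^ j ≤ m) :
    ∫ y, (upperFinsets (d + 2) (m / 2 ^ j + 1)).sup' (upperFinsets_nonempty _ _)
      (fun V => ∑ x ∈ dyadicShell j V, noise θ y x) ∂(dataLaw θ) ≤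
        (2 ^ (d + 2) + (d + 2)) * (m : ℝ) ^ (d + 1) * (t ^ d) ^ j := by
  classical
  -- `l = 2 ^ (-j q / 2)` equalises the entropy and the variance terms of the maximal inequality
  set l := (t ^ j) ^ (d + 2) with hl
  have hl0 : 0 < l := by positivity
  have h := integral_sup'_sum_noise_le θ _ (upperFinsets_nonempty (d + 2) (m / 2 ^ j + 1))
    (fun V => dyadicShell (m := m) j V) (v := (d + 2) * (m : ℝ) ^ (d + 1) * 2 ^ (j + 1)) (l := l)
    (fun V hV => by exact_mod_cast card_dyadicShell_le j (mem_upperFinsets.1 hV)) hl0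
  have htj : (t ^ j) ^ 2 * 2 ^ j = 1 := by
    rw [← pow_mul, mul_comm j, pow_mul, ht2, ← mul_pow]; norm_num
  have hlog : Real.log (upperFinsets (d + 2) (m / 2 ^ j + 1)).card ≤
      2 * ((m / 2 ^ j : ℕ) + 1 : ℝ) ^ (d + 1) := by
    have h1 : ((upperFinsets (d + 2) (m / 2 ^ j + 1)).card : ℝ) ≤
        4 ^ (m / 2 ^ j + 1) ^ (d + 1) := by
      exact_mod_cast card_upperFinsets_le d (m / 2 ^ j + 1)
    have h0 : (0 : ℝ) < (upperFinsets (d + 2) (m / 2 ^ j + 1)).card := by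
      exact_mod_cast (upperFinsets_nonempty (d + 2) (m / 2 ^ j + 1)).card_pos
    refine (Real.log_le_log h0 h1).trans ?_
    rw [Real.log_pow]
    have h4 : Real.log 4 ≤ 2 := by
      rw [show (4 : ℝ) = 2 ^ 2 by norm_num, Real.log_pow]
      push_cast
      linarith [Real.log_two_lt_d9]
    push_cast
    rw [mul_comm]
    gcongr
  have ha : ((m / 2 ^ j : ℕ) + 1 : ℝ) ≤ 2 * m * (t ^ j) ^ 2 := by
    have h1 : ((m / 2 ^ j : ℕ) : ℝ) ≤ m / (2 ^ j : ℕ) := Nat.cast_div_le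
    have h2 : (1 : ℝ) ≤ m / 2 ^ j := by
      rw [one_le_div (by positivity)]
      exact_mod_cast hj
    have h3 : (t ^ j) ^ 2 = 1 / 2 ^ j := eq_one_div_of_mul_eq_one_left htj
    push_cast at h1
    rw [h3, mul_one_div, mul_div_assoc]
    linarith
  have hent : Real.log (upperFinsets (d + 2) (m / 2 ^ j + 1)).card / l ≤
      2 ^ (d + 2) * (m : ℝ) ^ (d + 1) * (t ^ d) ^ j := by
    rw [div_le_iff₀ hl0]
    refine hlog.trans ?_
    calc 2 * ((m / 2 ^ j : ℕ) + 1 : ℝ) ^ (d + 1) ≤ 2 * (2 * m * (t ^ j) ^ 2) ^ (d + 1) := by gcongr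
      _ = _ := by rw [hl]; ring
  have hvar : l * ((d + 2) * (m : ℝ) ^ (d + 1) * 2 ^ (j + 1)) / 8 ≤
      (d + 2) * (m : ℝ) ^ (d + 1) * (t ^ d) ^ j := by
    have e : l * ((d + 2) * (m : ℝ) ^ (d + 1) * 2 ^ (j + 1)) / 8 =
        ((d + 2) * (m : ℝ) ^ (d + 1) * (t ^ d) ^ j) * ((t ^ j) ^ 2 * 2 ^ j) / 4 := by
      rw [hl]; ring
    rw [e, htj]
    have : 0 ≤ (d + 2) * (m : ℝ) ^ (d + 1) * (t ^ d) ^ j := by positivity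
    linarith
  linarith

lemma integral_abs_sum_noise_le [NeZero m] (θ : EuclideanSpace ℝ (Fin (d + 2) → Fin m)) :
    ∫ y, |∑ x, noise θ y x| ∂(dataLaw θ) ≤ 5 * (m : ℝ) ^ (d + 1) := by
  have hm : (1 : ℝ) ≤ m := by exact_mod_cast NeZero.one_le
  set A := (m : ℝ) ^ (d + 1) with hA
  have hmA : (m : ℝ) ≤ A := le_self_pow₀ hm (by omega)
  have hA0 : 0 < A := by positivity
  have h2 := integral_sq_sum_noise_le θ fun _ => 1
  have hcard : ∑ _x : Fin (d + 2) → Fin m, (1 : ℝ) ^ 2 = A * m := by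
    simp [hA, pow_succ]
  rw [hcard] at h2
  simp only [one_mul] at h2
  calc _ ≤ ∫ y, ((∑ x, noise θ y x) ^ 2 / A + A) / 2 ∂(dataLaw θ) := by
        refine integral_mono Integrable.of_finite Integrable.of_finite fun y => ?_
        simp only
        rw [le_div_iff₀ two_pos, div_add' _ _ _ hA0.ne', le_div_iff₀ hA0, ← sq_abs]
        nlinarith [sq_nonneg (|∑ x, noise θ y x| - A)]
    _ = ((∫ y, (∑ x, noise θ y x) ^ 2 ∂(dataLaw θ)) / A + A) / 2 := by
        rw [integral_div, integral_add Integrable.of_finite Integrable.of_finite, integral_div]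
        simp
    _ ≤ (8 * (A * m) / A + A) / 2 := by gcongr
    _ ≤ 5 * A := by
        rw [show 8 * (A * m) / A = 8 * m by field_simp]
        linarith

/-- Risk of the least squares estimator over monotone vectors, by chaining over dyadic scales. -/
lemma minimaxRisk_evaluations_le_sum {M : ℝ} (hM : 0 < M) {K : ℕ} (hK : 2 ^ K ≤ m)
    (hK' : m ≤ 2 ^ (K + 1)) {t : ℝ} (ht : 0 < t) (ht2 : t ^ 2 = 1 / 2) :
    minimaxRisk (evaluations (d + 2) m (-M) M) ≤
      ENNReal.ofReal (4 / Real.sigmoid (-M) ^ 4 * (2 * (m : ℝ) ^ (d + 1) *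
        ((2 ^ (d + 2) + (d + 2)) * ∑ j ∈ Finset.range (K + 1), (t ^ d) ^ j + 5))) := by
  have : NeZero m := ⟨by have : 0 < 2 ^ K := by positivity
                         omega⟩
  choose g hg hmin using fun y : (Fin (d + 2) → Fin m) → Bool =>
    exists_leastSquares fun x => outcome (y x)
  refine minimaxRisk_le_of_estimator hM (fun θ hθ => mem_Icc_of_mem_evaluations hθ) g
    fun θ hθ => ?_
  have hp : (fun x => Real.sigmoid (θ x)) ∈ monotoneVectors (d + 2) m :=
    ⟨⟨fun x => Real.sigmoid_nonneg _, fun x => Real.sigmoid_le_one _⟩,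
      Real.sigmoid_monotone.comp (monotone_of_mem_evaluations hθ)⟩
  let F : ℕ → ((Fin (d + 2) → Fin m) → Bool) → ℝ := fun j y =>
    (upperFinsets (d + 2) (m / 2 ^ j + 1)).sup' (upperFinsets_nonempty _ _)
      fun V => ∑ x ∈ dyadicShell j V, noise θ y x
  have hpt (y : (Fin (d + 2) → Fin m) → Bool) : ∑ x, (g y x - Real.sigmoid (θ x)) ^ 2 ≤
      2 * ((∑ j ∈ Finset.range (K + 1), F j y + |∑ x, noise θ y x|) -
        ∑ x, Real.sigmoid (θ x) * noise θ y x) := by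
    refine (sum_sq_leastSquares_le (hmin y _ hp)).trans ?_
    have hsup := sum_mul_le_of_forall_upperSet (ξ := noise θ y) (hg y)
      (B := ∑ j ∈ Finset.range (K + 1), F j y + |∑ x, noise θ y x|) fun U hU => by
        obtain ⟨V, hV, hle⟩ := exists_sum_upperSet_le hK' (mem_upperFinsets.1 hU) (noise θ y)
        refine hle.trans (add_le_add (Finset.sum_le_sum fun j _ => ?_) le_rfl)
        exact Finset.le_sup' (fun V => ∑ x ∈ dyadicShell j V, noise θ y x) (hV j)
    refine mul_le_mul_of_nonneg_left ?_ zero_le_two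
    exact sub_le_sub_right hsup _
  have hint := integral_mono (μ := dataLaw θ) Integrable.of_finite Integrable.of_finite hpt
  rw [integral_const_mul, integral_sub Integrable.of_finite Integrable.of_finite,
    integral_add Integrable.of_finite Integrable.of_finite,
    integral_finsetSum (Finset.range (K + 1)) fun _ _ => Integrable.of_finite,
    integral_sum_noise] at hint
  have hF : ∑ j ∈ Finset.range (K + 1), ∫ y, F j y ∂(dataLaw θ) ≤
      ∑ j ∈ Finset.range (K + 1), (2 ^ (d + 2) + (d + 2)) * (m : ℝ) ^ (d + 1) * (t ^ d) ^ j :=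
    Finset.sum_le_sum fun j hj => integral_sup'_dyadicShell_le θ ht ht2
      ((Nat.pow_le_pow_right two_pos (Nat.lt_succ_iff.1 (Finset.mem_range.1 hj))).trans hK)
  rw [← Finset.mul_sum] at hF
  have habs := integral_abs_sum_noise_le θ
  refine hint.trans ?_
  nlinarith

end Chaining

/-! ### Evaluation of the bounds -/

lemma exists_two_pow_le {m : ℕ} (hm : 1 ≤ m) : ∃ K : ℕ, 2 ^ K ≤ m ∧ m ≤ 2 ^ (K + 1) :=
  ⟨Nat.log 2 m, Nat.pow_log_le_self 2 (by omega), (Nat.lt_pow_succ_log_self one_lt_two m).le⟩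

lemma inv_sqrt_two_sq : (Real.sqrt 2)⁻¹ ^ 2 = (1 / 2 : ℝ) := by
  rw [inv_pow, Real.sq_sqrt (by norm_num), one_div]

/-- In dimension two all dyadic scales contribute equally, which produces the logarithm. -/
lemma minimaxRisk_evaluations_two_le {M : ℝ} (hM : 0 < M) {m : ℕ} (hm : 2 ≤ m) :
    minimaxRisk (evaluations 2 m (-M) M) ≤
      ENNReal.ofReal (4 / Real.sigmoid (-M) ^ 4 * 44 * (m * Real.log (m ^ 2 : ℝ))) := by
  obtain ⟨K, hK, hK'⟩ := exists_two_pow_le (m := m) (by omega)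
  have h := minimaxRisk_evaluations_le_sum (d := 0) hM hK hK'
    (inv_pos.2 (Real.sqrt_pos.2 two_pos)) inv_sqrt_two_sq
  refine h.trans (ENNReal.ofReal_le_ofReal ?_)
  have hσ := Real.sigmoid_pos (-M)
  have hlogK : K * Real.log 2 ≤ Real.log m := by
    rw [← Real.log_pow]
    exact Real.log_le_log (by positivity) (by exact_mod_cast hK)
  have hlog2 : Real.log 2 ≤ Real.log m :=
    Real.log_le_log two_pos (by exact_mod_cast hm)
  have hl := Real.log_two_gt_d9
  rw [Real.log_pow, mul_assoc _ (44 : ℝ)]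
  refine mul_le_mul_of_nonneg_left ?_ (by positivity)
  simp only [pow_zero, one_pow, Finset.sum_const, Finset.card_range, nsmul_eq_mul, mul_one,
    Nat.cast_zero, zero_add, pow_one]
  push_cast
  have hb : (2 ^ 2 + 2 : ℝ) * (K + 1) + 5 ≤ 44 * Real.log m := by
    have : (K : ℝ) ≤ 2 * Real.log m := by
      have : (0 : ℝ) ≤ K := by positivity
      nlinarith
    linarith
  calc 2 * (m : ℝ) * ((2 ^ 2 + 2 : ℝ) * (K + 1) + 5) ≤ 2 * m * (44 * Real.log m) := by gcongr
    _ = _ := by ring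

/-- In dimension at least three the contributions of the scales decrease geometrically. -/
lemma minimaxRisk_evaluations_add_three_le {M : ℝ} (hM : 0 < M) (d : ℕ) {m : ℕ} (hm : 1 ≤ m) :
    minimaxRisk (evaluations (d + 3) m (-M) M) ≤
      ENNReal.ofReal (4 / Real.sigmoid (-M) ^ 4 * (2 * ((2 ^ (d + 3) + (d + 3)) * 4 + 5)) *
        (m : ℝ) ^ (d + 2)) := by
  obtain ⟨K, hK, hK'⟩ := exists_two_pow_le hm
  set t := (Real.sqrt 2)⁻¹ with ht
  have ht0 : 0 < t := inv_pos.2 (Real.sqrt_pos.2 two_pos)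
  have ht2 : t ^ 2 = 1 / 2 := inv_sqrt_two_sq
  have ht1 : t ≤ 3 / 4 := by nlinarith
  have h := minimaxRisk_evaluations_le_sum (d := d + 1) hM hK hK' ht0 ht2
  refine h.trans (ENNReal.ofReal_le_ofReal ?_)
  have hσ := Real.sigmoid_pos (-M)
  have hgeo : ∑ j ∈ Finset.range (K + 1), (t ^ (d + 1)) ^ j ≤ 4 := by
    have hτ0 : 0 ≤ t ^ (d + 1) := by positivity
    have hτ : t ^ (d + 1) ≤ 3 / 4 :=
      (pow_le_of_le_one ht0.le (by linarith) (by omega)).trans ht1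
    have h1 : ∑ j ∈ Finset.range (K + 1), (t ^ (d + 1)) ^ j ≤ (1 - t ^ (d + 1))⁻¹ := by
      rw [← tsum_geometric_of_lt_one hτ0 (by linarith)]
      exact (summable_geometric_of_lt_one hτ0 (by linarith)).sum_le_tsum _
        fun j _ => by positivity
    refine h1.trans ?_
    rw [inv_le_comm₀ (by linarith) (by norm_num)]
    linarith
  rw [mul_assoc (4 / _)]
  refine mul_le_mul_of_nonneg_left ?_ (by positivity)
  push_cast
  calc _ ≤ 2 * (m : ℝ) ^ (d + 1 + 1) * ((2 ^ (d + 1 + 2) + (d + 1 + 2)) * 4 + 5) := by gcongr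
    _ = _ := by ring

end MonotoneBernoulli

open MonotoneBernoulli

theorem mainTheorem7 (M : ℝ) (hM : 0 < M) :
    (∃ c C : ℝ, 0 < c ∧ 0 < C ∧ ∀ m n : ℕ, 1 ≤ n → n = m ^ 1 →
      ENNReal.ofReal (c * (n : ℝ) ^ (1 / 3 : ℝ)) ≤
          MonotoneBernoulli.minimaxRisk (MonotoneBernoulli.evaluations 1 m (-M) M) ∧
        MonotoneBernoulli.minimaxRisk (MonotoneBernoulli.evaluations 1 m (-M) M) ≤
          ENNReal.ofReal (C * (n : ℝ) ^ (1 / 3 : ℝ))) ∧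
    (∃ C : ℝ, 0 < C ∧ ∀ m n : ℕ, 2 ≤ n → n = m ^ 2 →
      MonotoneBernoulli.minimaxRisk (MonotoneBernoulli.evaluations 2 m (-M) M) ≤
        ENNReal.ofReal (C * (Real.sqrt n * Real.log n))) ∧
    (∀ q : ℕ, 3 ≤ q → ∃ c C : ℝ, 0 < c ∧ 0 < C ∧ ∀ m n : ℕ, 1 ≤ n → n = m ^ q →
      ENNReal.ofReal (c * (n : ℝ) ^ (1 - 1 / (q : ℝ))) ≤
          MonotoneBernoulli.minimaxRisk (MonotoneBernoulli.evaluations q m (-M) M) ∧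
        MonotoneBernoulli.minimaxRisk (MonotoneBernoulli.evaluations q m (-M) M) ≤
          ENNReal.ofReal (C * (n : ℝ) ^ (1 - 1 / (q : ℝ)))) := by
  have hσ := Real.sigmoid_pos (-M)
  have hκ : 0 < min M 1 := lt_min hM zero_lt_one
  refine ⟨⟨min M 1 ^ 2 / 128, 4 / Real.sigmoid (-M) ^ 4 * 2376, by positivity, by positivity,
    ?_⟩, ⟨4 / Real.sigmoid (-M) ^ 4 * 44, by positivity, ?_⟩, fun q hq => ?_⟩
  · rintro m n hn rfl
    rw [pow_one] at hn ⊢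
    refine ⟨le_minimaxRisk_evaluations_one hn hM, ?_⟩
    rw [mul_assoc]
    exact minimaxRisk_evaluations_one_le hM hn
  · rintro m n hn rfl
    have hm : 2 ≤ m := by
      by_contra! h
      interval_cases m <;> omega
    push_cast
    rw [Real.sqrt_sq (by positivity)]
    exact minimaxRisk_evaluations_two_le hM hm
  · obtain ⟨d, rfl⟩ : ∃ d, q = d + 3 := ⟨q - 3, by omega⟩
    refine ⟨min M 1 ^ 2 / (16 * (d + 3 : ℕ)),
      4 / Real.sigmoid (-M) ^ 4 * (2 * ((2 ^ (d + 3) + (d + 3)) * 4 + 5)), by positivity,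
      by positivity, ?_⟩
    rintro m n hn rfl
    have hm : 1 ≤ m := by
      by_contra! h
      interval_cases m
      simp at hn
    have e : (((m ^ (d + 3) : ℕ) : ℝ)) ^ (1 - 1 / ((d + 3 : ℕ) : ℝ)) = (m : ℝ) ^ (d + 2) := by
      push_cast
      rw [← Real.rpow_natCast, ← Real.rpow_mul (by positivity), ← Real.rpow_natCast]
      congr 1
      push_cast
      field_simp
      ring
    rw [e]
    exact ⟨le_minimaxRisk_evaluations (by omega) hm hM,
      minimaxRisk_evaluations_add_three_le hM d hm⟩
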